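/- Let $n\ge 1$, and consider on $\mathbb R^n$ the system $d\mathbf x=\mathbf F(\mathbf x,s)\,ds+\mathbf B(\mathbf x,s)\,d\mathbf w$, where $\mathbf F=(F_1,\dots,F_n)$ is $C^1$ in $(\mathbf x,s)$, $\mathbf B=(b_{ij})$ is a continuous $n\times m$ matrix function, $\mathbf w$ is a vector of $m$ independent standard Wiener processes, and $g_{ij}=\sum_k b_{ik}b_{jk}$. Let $t<t_1$, and let $\mathbf x(s)=(x_1(s),\mathbf x_{\rm others}(s))$, $\mathbf x_{\rm others}=(x_2,\dots,x_n)$, be a (weak) solution on $[t,t_1]$ with probability density $\rho(s,\cdot)$, such that $\rho(t,\cdot)$ is $C^2$ and compactly supported. Put $\rho_{\rm others}(s,\cdot)=\int_{\mathbb R}\rho(s,x_1,\cdot)\,dx_1$ and $H_{\rm others}(s)=-\int\rho_{\rm others}\log\rho_{\rm others}\,d\mathbf x_{\rm others}$. The modified system is obtained on $[t,t_1]$ by removing the equation of $x_1$ and freezing $x_1$ as a parameter. Let $\mathbf y(s)$ be its solution with $\mathbf y(t)=\mathbf x_{\rm others}(t)$ and parameter $x_1(t)$, and suppose that $(x_1(t),\mathbf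 y(s))$ has a density $q(s,\cdot)$. For each $a\in\mathbb R$, let $\rho_{\backslash 1}(s,a,\cdot)$ be the density at time $s$ of a solution of the modified system with parameter $a$ whose density at time $t$ is $\rho_{\rm others}(t,\cdot)$. Put $H_{{\rm others},\backslash 1}(s)=-E\big[\log\rho_{\backslash 1}(s,x_1(t),\mathbf y(s))\big]$. The information flow from $x_1$ to $\mathbf x_{\rm others}$ at time $t$ is $$T_{1\to{\rm others}}=\frac{dH_{\rm others}}{ds}\Big|_{s=t^+}-\frac{dH_{{\rm others},\backslash 1}}{ds}\Big|_{s=t^+}.$$ Assume the following regularity in time. (a) $\rho$, $q$ and (for each $a$) $\rho_{\backslash 1}(\cdot,a,\cdot)$ are, almost everywhere in space, right-differentiable in $s$ at $s=t$. (b) The difference quotients at $t$, over $s\in(t,t_1)$, of these densities and of the entropy integrands $\rho_{\rm others}\log\rho_{\rm others}$ and $q\log\rho_{\backslash 1}$ are dominated by integrable functions of the space variables. (c) At almost every point where $\rho_{\rm others}(t,\cdot)=0$ these two integrands are $o(s-t)$ as $s\to t^+$ (with $0\log 0=0$). If $\mathbf B$ does not depend on $\mathbf x$ (additive noise), then the two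 derivatives that define $T_{1\to{\rm others}}$ exist, the stochastic term vanishes, $$\frac12E\Big[\sum_{i=2}^n\sum_{j=2}^n\frac1{\rho_{\rm others}}\frac{\partial^2(g_{ij}\rho_{\rm others})}{\partial x_i\partial x_j}\Big]=0,$$ and $$T_{1\to{\rm others}}=-E\Big[\sum_{i=2}^n\frac1{\rho_{\rm others}}\frac{\partial(F_i\rho_{\rm others})}{\partial x_i}\Big],$$ where everything is evaluated at time $t$ and at $\mathbf x(t)$, and both expectations are of integrable random variables. -/

import Mathlib

open MeasureTheory ProbabilityTheory Filter Set Topology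

noncomputable section

namespace InfoFlow

/-- The partial derivative of `f` with respect to the `i`-th coordinate at `x`. -/
def pd {k : ℕ} (i : Fin k) (f : (Fin k → ℝ) → ℝ) (x : Fin k → ℝ) : ℝ :=
  lineDeriv ℝ f x (Pi.single i 1)

/-- The entries `g i j = ∑ l, b i l * b j l` of `B Bᵀ`. -/
def gMat {k m : ℕ} (B : ℝ → (Fin k → ℝ) → Matrix (Fin k) (Fin m) ℝ)
    (s : ℝ) (x : Fin k → ℝ) (i j : Fin k) : ℝ :=
  ∑ l, B s x i l * B s x j l

/-- The generator at time `s` of the system `dx = F(x, s) ds + B(x, s) dw`. -/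
def generator {k m : ℕ} (F : ℝ → (Fin k → ℝ) → Fin k → ℝ)
    (B : ℝ → (Fin k → ℝ) → Matrix (Fin k) (Fin m) ℝ)
    (s : ℝ) (φ : (Fin k → ℝ) → ℝ) (x : Fin k → ℝ) : ℝ :=
  ∑ i, F s x i * pd i φ x
    + (1 / 2) * ∑ i, ∑ j, gMat B s x i j * pd i (fun z => pd j φ z) x

/-- `Z` is a (weak) solution on the time interval `[t, t₁]` of `dx = F(x, s) ds + B(x, s) dw`,
`w` a vector of `m` independent standard Wiener processes, expressed by the martingale
problem: `Z` has continuous paths, and for every smooth compactly supported `φ` the process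
`φ(Z_s) - ∫_t^s (L_r φ)(Z_r) dr` is a martingale for a filtration to which `Z` is adapted. -/
structure IsSolution {k m : ℕ} (F : ℝ → (Fin k → ℝ) → Fin k → ℝ)
    (B : ℝ → (Fin k → ℝ) → Matrix (Fin k) (Fin m) ℝ) (t t₁ : ℝ)
    {Ω : Type*} [mΩ : MeasurableSpace Ω] (P : Measure Ω) (Z : ℝ → Ω → Fin k → ℝ) : Prop where
  continuous_paths : ∀ ω, ContinuousOn (fun s => Z s ω) (Icc t t₁)
  martingale : ∃ ℱ : Filtration (Icc t t₁) mΩ,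
    Adapted ℱ (fun s : Icc t t₁ => Z s) ∧
    ∀ φ : (Fin k → ℝ) → ℝ, ContDiff ℝ ((⊤ : ℕ∞) : WithTop ℕ∞) φ → HasCompactSupport φ →
      Martingale (fun (s : Icc t t₁) ω =>
        φ (Z s ω) - ∫ r in t..(s : ℝ), generator F B r φ (Z r ω)) ℱ P

/-- `p` is a probability density function of the random vector `Z` under `P`. -/
structure IsDensity {k : ℕ} {Ω : Type*} [MeasurableSpace Ω] (P : Measure Ω)
    (Z : Ω → Fin k → ℝ) (p : (Fin k → ℝ) → ℝ) : Prop where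
  measurable : Measurable p
  nonneg : ∀ x, 0 ≤ p x
  map_eq : P.map Z = volume.withDensity (fun x => ENNReal.ofReal (p x))

/-- The components `(x_2, ..., x_n)` of `x = (x_1, ..., x_n)`, where `n = d + 1`. The component
`x_1` is `x 0`, and `x_{i+1}` is `x i.succ` for `i : Fin d`. -/
def others {d : ℕ} (x : Fin (d + 1) → ℝ) : Fin d → ℝ := fun i => x i.succ

/-- The marginal density of `(x_2, ..., x_n)`: integrate `x_1` out. -/
def marginal {d : ℕ} (p : (Fin (d + 1) → ℝ) → ℝ) (y : Fin d → ℝ) : ℝ :=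
  ∫ a : ℝ, p (Fin.cons a y)

/-- The drift of the modified system on `ℝⁿ`, in which `x_1` is frozen (`dx_1 = 0`). -/
def stopDrift {d : ℕ} (F : ℝ → (Fin (d + 1) → ℝ) → Fin (d + 1) → ℝ) :
    ℝ → (Fin (d + 1) → ℝ) → Fin (d + 1) → ℝ :=
  fun s x => Fin.cons 0 (fun i : Fin d => F s x i.succ)

/-- The noise matrix of the modified system on `ℝⁿ`, in which `x_1` is frozen. -/
def stopNoise {d m : ℕ} (B : ℝ → (Fin (d + 1) → ℝ) → Matrix (Fin (d + 1)) (Fin m) ℝ) :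
    ℝ → (Fin (d + 1) → ℝ) → Matrix (Fin (d + 1)) (Fin m) ℝ :=
  fun s x => Matrix.of (Fin.cons (fun _ => 0) (fun (i : Fin d) l => B s x i.succ l))

/-- The drift of the modified system for `(x_2, ..., x_n)`, with `x_1 = a` as a parameter. -/
def paramDrift {d : ℕ} (F : ℝ → (Fin (d + 1) → ℝ) → Fin (d + 1) → ℝ) (a : ℝ) :
    ℝ → (Fin d → ℝ) → Fin d → ℝ :=
  fun s y i => F s (Fin.cons a y) i.succ

/-- The noise matrix of the modified system for `(x_2, ..., x_n)`, with `x_1 = a` as a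
parameter. -/
def paramNoise {d m : ℕ} (B : ℝ → (Fin (d + 1) → ℝ) → Matrix (Fin (d + 1)) (Fin m) ℝ) (a : ℝ) :
    ℝ → (Fin d → ℝ) → Matrix (Fin d) (Fin m) ℝ :=
  fun s y => Matrix.of (fun i l => B s (Fin.cons a y) i.succ l)

/-- `Y` is `(x_2, ..., x_n)` in the modified system: it starts at time `t` from the state `X t`
of the original system, and from then on `x_1` keeps its value at time `t`. -/
structure IsModified {d m : ℕ} (F : ℝ → (Fin (d + 1) → ℝ) → Fin (d + 1) → ℝ)
    (B : ℝ → (Fin (d + 1) → ℝ) → Matrix (Fin (d + 1)) (Fin m) ℝ) (t t₁ : ℝ)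
    {Ω : Type*} [MeasurableSpace Ω] (P : Measure Ω)
    (X : ℝ → Ω → Fin (d + 1) → ℝ) (Y : ℝ → Ω → Fin d → ℝ) : Prop where
  initial : ∀ ω, Y t ω = others (X t ω)
  solution : IsSolution (stopDrift F) (stopNoise B) t t₁ P
    (fun s ω => Fin.cons (X t ω 0) (Y s ω))

/-- `r s a y` is, for each value `a` of the frozen component `x_1`, the density at `y` and at time
`s` of the solution of the modified system with parameter `a` whose density at time `t` is
`p₀`. -/
structure IsFrozenDensity {d m : ℕ} (F : ℝ → (Fin (d + 1) → ℝ) → Fin (d + 1) → ℝ)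
    (B : ℝ → (Fin (d + 1) → ℝ) → Matrix (Fin (d + 1)) (Fin m) ℝ) (t t₁ : ℝ)
    (p₀ : (Fin d → ℝ) → ℝ) (r : ℝ → ℝ → (Fin d → ℝ) → ℝ) : Prop where
  measurable : ∀ s ∈ Icc t t₁, Measurable (fun z : ℝ × (Fin d → ℝ) => r s z.1 z.2)
  initial : ∀ a y, r t a y = p₀ y
  solution : ∀ a : ℝ, ∃ (Ω : Type) (_ : MeasurableSpace Ω) (P : Measure Ω)
    (Z : ℝ → Ω → Fin d → ℝ), IsProbabilityMeasure P ∧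
      IsSolution (paramDrift F a) (paramNoise B a) t t₁ P Z ∧
      ∀ s ∈ Icc t t₁, IsDensity P (Z s) (r s a)

/-- The joint entropy (in nats) at time `s` of `(x_2, ..., x_n)`, for `ρ s` the density
of `x` at time `s`. -/
def entropyOthers {d : ℕ} (ρ : ℝ → (Fin (d + 1) → ℝ) → ℝ) (s : ℝ) : ℝ :=
  -∫ y, marginal (ρ s) y * Real.log (marginal (ρ s) y)

/-- The joint entropy at time `s` of `(x_2, ..., x_n)` with the effect of `x_1` excluded from time
`t` on: minus the expectation of the logarithm of the frozen density along the modified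
system. -/
def entropyExcl {d : ℕ} {Ω : Type*} [MeasurableSpace Ω] (P : Measure Ω) (t : ℝ)
    (X : ℝ → Ω → Fin (d + 1) → ℝ) (Y : ℝ → Ω → Fin d → ℝ)
    (r : ℝ → ℝ → (Fin d → ℝ) → ℝ) (s : ℝ) : ℝ :=
  -∫ ω, Real.log (r s (X t ω 0) (Y s ω)) ∂P

/-- The information flow at time `t` from `x_1` to `(x_2, ..., x_n)`: the rate of change of the
joint entropy of `(x_2, ..., x_n)` minus its rate of change with the effect of `x_1` excluded
(the modified system exists only from `t` on, so that both rates are taken to the right). -/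
def infoFlow {d : ℕ} {Ω : Type*} [MeasurableSpace Ω] (P : Measure Ω) (t : ℝ)
    (X : ℝ → Ω → Fin (d + 1) → ℝ) (Y : ℝ → Ω → Fin d → ℝ)
    (ρ : ℝ → (Fin (d + 1) → ℝ) → ℝ) (r : ℝ → ℝ → (Fin d → ℝ) → ℝ) : ℝ :=
  derivWithin (entropyOthers ρ) (Ici t) t - derivWithin (entropyExcl P t X Y r) (Ici t) t

/-- The integrand `∑_{i ≥ 2} (1 / ρ_others) ∂(F_i ρ_others) / ∂x_i` at time `t`; the partial
derivatives are those of functions of `x = (x_1, ..., x_n)`. -/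
def driftTerm {d : ℕ} (F : ℝ → (Fin (d + 1) → ℝ) → Fin (d + 1) → ℝ)
    (ρ : ℝ → (Fin (d + 1) → ℝ) → ℝ) (t : ℝ) (x : Fin (d + 1) → ℝ) : ℝ :=
  ∑ i : Fin d, 1 / marginal (ρ t) (others x) *
    pd i.succ (fun z => F t z i.succ * marginal (ρ t) (others z)) x

/-- The integrand `∑_{i, j ≥ 2} (1 / ρ_others) ∂²(g_ij ρ_others) / ∂x_i ∂x_j` at time `t`. -/
def noiseTerm {d m : ℕ} (B : ℝ → (Fin (d + 1) → ℝ) → Matrix (Fin (d + 1)) (Fin m) ℝ)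
    (ρ : ℝ → (Fin (d + 1) → ℝ) → ℝ) (t : ℝ) (x : Fin (d + 1) → ℝ) : ℝ :=
  ∑ i : Fin d, ∑ j : Fin d, 1 / marginal (ρ t) (others x) *
    pd i.succ (fun z => pd j.succ
      (fun u => gMat B t u i.succ j.succ * marginal (ρ t) (others u)) z) x

/-- The difference quotients at `t` of `s ↦ f s x`, for `s` in `(t, t₁)`, have a bound that
is integrable in `x`. -/
def DominatedQuotients {k : ℕ} (f : ℝ → (Fin k → ℝ) → ℝ) (t t₁ : ℝ) : Prop :=
  ∃ G : (Fin k → ℝ) → ℝ, Integrable G ∧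
    ∀ᵐ x, ∀ s ∈ Ioo t t₁, |f s x - f t x| ≤ (s - t) * G x

/-- `s ↦ f s x` has a right derivative at `t` for almost every `x`, with integrably dominated
difference quotients. -/
def RightDiffDominated {k : ℕ} (f : ℝ → (Fin k → ℝ) → ℝ) (t t₁ : ℝ) : Prop :=
  (∀ᵐ x, DifferentiableWithinAt ℝ (fun s => f s x) (Ici t) t) ∧ DominatedQuotients f t t₁

/-- The regularity in time, at time `t`, that allows the densities and the two entropies to be
differentiated under the integral sign. Here `ρ` is the density of the original system, `q` that
of the modified system (with its frozen component `x_1`), and `r` the frozen density. Where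
`ρ_others` vanishes, the integrands of the entropies must not vary at first order. -/
structure RegularInTime {d : ℕ} (ρ q : ℝ → (Fin (d + 1) → ℝ) → ℝ)
    (r : ℝ → ℝ → (Fin d → ℝ) → ℝ) (t t₁ : ℝ) : Prop where
  density : RightDiffDominated ρ t t₁
  density_modified : RightDiffDominated q t t₁
  density_frozen : ∀ a, RightDiffDominated (fun s y => r s a y) t t₁
  entropy_dominated : DominatedQuotients
    (fun s y => marginal (ρ s) y * Real.log (marginal (ρ s) y)) t t₁
  entropy_zero : ∀ᵐ y, marginal (ρ t) y = 0 →
    (fun s => marginal (ρ s) y * Real.log (marginal (ρ s) y)) =o[𝓝[>] t] (fun s => s - t)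
  excl_dominated : DominatedQuotients
    (fun s (x : Fin (d + 1) → ℝ) => q s x * Real.log (r s (x 0) (others x))) t t₁
  excl_zero : ∀ᵐ x, marginal (ρ t) (others x) = 0 →
    (fun s => q s x * Real.log (r s (x 0) (others x))) =o[𝓝[>] t] (fun s => s - t)

end InfoFlow

end

/-! Write p for the density of the other components at time t, and ρ', q' for the right derivatives
at t of ρ and q. Differentiation under the integral sign gives the two entropy rates -∫ (w' + w' log
p), with w' the marginal of ρ', and -∫ (q' log p + q K / p), where K(a, ·) is the rate of change of
the frozen density with parameter a. Conservation of mass gives ∫ w' = 0. On functions of the other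
components alone, freezing x_1 does not change the generator (`generator_comp_others`); hence ρ' and
q' have the same marginal (`ae_eq_marginal_of_integral_mul_eq`) and the logarithmic terms cancel.
What is left is T = ∫ ρ K / p.

For additive noise the Fokker-Planck equation of each frozen system
(`IsSolution.derivWithin_density_ae_eq`) gives K = -∑ ∂_i(F_i p) + (1/2) ∑ g_ij ∂_i ∂_j p, so T is
minus the drift expectation plus half the noise expectation. Integrating x_1 out of the latter
cancels the factor 1/p and leaves ∑ g_ij ∫ ∂_i ∂_j p = 0, as p has compact support.

Two points need care. On the zero set of p, logarithms and quotients are meaningless: there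
`deriv_eq_zero_of_mul_log_isLittleO` and `ae_pd_pd_eq_zero` make the formulas hold with the
conventions log 0 = 0 and 1/0 = 0. And K is known only off a null set that depends on a; gluing
these sets by Fubini requires measurability, which is available for convergence along a sequence of
times. Hence the sequential form of `hasDerivWithinAt_integral_of_dominated_slopes`. -/

namespace InfoFlow

/-! ### Right derivatives of integrals, logarithmic slopes, and zero sets. -/

/-- Differentiation under the integral sign, to the right at `t`, with dominated difference
quotients that converge almost everywhere along each sequence of times. -/
theorem hasDerivWithinAt_integral_of_dominated_slopes {α : Type*} [MeasurableSpace α]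
    {μ : Measure α} {f : ℝ → α → ℝ} {f' G : α → ℝ} {t t₁ : ℝ} (ht : t < t₁)
    (hmeas : ∀ s ∈ Icc t t₁, AEStronglyMeasurable (f s) μ) (hint : Integrable (f t) μ)
    (hG : Integrable G μ)
    (hdom : ∀ᵐ x ∂μ, ∀ s ∈ Ioo t t₁, |f s x - f t x| ≤ (s - t) * G x)
    (hlim : ∀ u : ℕ → ℝ, Tendsto u atTop (𝓝[>] t) →
      ∀ᵐ x ∂μ, Tendsto (fun n => (u n - t)⁻¹ * (f (u n) x - f t x)) atTop (𝓝 (f' x))) :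
    Integrable f' μ ∧
      HasDerivWithinAt (fun s => ∫ x, f s x ∂μ) (∫ x, f' x ∂μ) (Ici t) t := by
  have hIoo : ∀ u : ℕ → ℝ, Tendsto u atTop (𝓝[>] t) → ∀ᶠ n in atTop, u n ∈ Ioo t t₁ :=
    fun u hu => hu.eventually (Ioo_mem_nhdsGT ht)
  have hintS : ∀ s ∈ Ioo t t₁, Integrable (fun x => f s x - f t x) μ := by
    intro s hs
    refine (hG.const_mul (s - t)).mono'
      ((hmeas s (Ioo_subset_Icc_self hs)).sub hint.aestronglyMeasurable) ?_
    filter_upwards [hdom] with x hx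
    exact hx s hs
  have hbd : ∀ s ∈ Ioo t t₁, ∀ᵐ x ∂μ, ‖(s - t)⁻¹ * (f s x - f t x)‖ ≤ G x := by
    intro s hs
    filter_upwards [hdom] with x hx
    have h0 : 0 < s - t := sub_pos.2 hs.1
    rw [norm_mul, norm_inv, Real.norm_of_nonneg h0.le, Real.norm_eq_abs,
      inv_mul_le_iff₀ h0]
    exact hx s hs
  obtain ⟨w, hw⟩ := exists_seq_tendsto (𝓝[>] t)
  have hf' : Integrable f' μ := by
    obtain ⟨N, hN⟩ := eventually_atTop.1 (hIoo w hw)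
    have hlimw := hlim (fun n => w (n + N)) (hw.comp (tendsto_add_atTop_nat N))
    have hwI : ∀ n, w (n + N) ∈ Ioo t t₁ := fun n => hN _ (Nat.le_add_left _ _)
    refine hG.mono' (aestronglyMeasurable_of_tendsto_ae atTop
      (fun n => ((hintS _ (hwI n)).const_mul _).aestronglyMeasurable) hlimw) ?_
    filter_upwards [hlimw, ae_all_iff.2 fun n => hbd _ (hwI n)] with x hx hb
    exact le_of_tendsto hx.norm (Eventually.of_forall hb)
  refine ⟨hf', ?_⟩
  rw [hasDerivWithinAt_iff_tendsto_slope, Ici_sdiff_left]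
  refine tendsto_of_seq_tendsto fun u hu => ?_
  have key : Tendsto (fun n => ∫ x, (u n - t)⁻¹ * (f (u n) x - f t x) ∂μ) atTop
      (𝓝 (∫ x, f' x ∂μ)) := by
    refine tendsto_integral_filter_of_dominated_convergence G ?_ ?_ hG (hlim u hu)
    · filter_upwards [hIoo u hu] with n hn
      exact ((hintS _ hn).const_mul _).aestronglyMeasurable
    · filter_upwards [hIoo u hu] with n hn
      exact hbd _ hn
  refine key.congr' ?_
  filter_upwards [hIoo u hu] with n hn
  have h1 : Integrable (f (u n)) μ := by
    exact ((hintS _ hn).add hint).congr (ae_of_all _ fun x => sub_add_cancel _ _)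
  rw [integral_const_mul, integral_sub h1 hint]
  simp [slope]

theorem tendsto_slope_of_hasDerivWithinAt_Ici {f : ℝ → ℝ} {f' t : ℝ}
    (h : HasDerivWithinAt f f' (Ici t) t) :
    Tendsto (fun s => (s - t)⁻¹ * (f s - f t)) (𝓝[>] t) (𝓝 f') := by
  rw [hasDerivWithinAt_iff_tendsto_slope, Ici_sdiff_left] at h
  exact h

/-- The slopes of a product `q * log r`, along a sequence. -/
theorem tendsto_slope_mul_log {q r : ℝ → ℝ} {q' r' t : ℝ} {u : ℕ → ℝ}
    (hu : Tendsto u atTop (𝓝[>] t)) (hr0 : r t ≠ 0)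
    (hq : Tendsto (fun n => (u n - t)⁻¹ * (q (u n) - q t)) atTop (𝓝 q'))
    (hr : Tendsto (fun n => (u n - t)⁻¹ * (r (u n) - r t)) atTop (𝓝 r')) :
    Tendsto (fun n => (u n - t)⁻¹ * (q (u n) * Real.log (r (u n)) - q t * Real.log (r t)))
      atTop (𝓝 (q' * Real.log (r t) + q t * (r' / r t))) := by
  have hpos : ∀ᶠ n in atTop, u n - t ≠ 0 := by
    filter_upwards [hu.eventually self_mem_nhdsWithin] with n hn
    exact (sub_pos.2 hn).ne'
  have hu0 : Tendsto (fun n => u n - t) atTop (𝓝 0) := by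
    simpa using (hu.mono_right nhdsWithin_le_nhds).sub_const t
  have hrt : Tendsto (fun n => r (u n)) atTop (𝓝 (r t)) := by
    have h := (hu0.mul hr).add_const (r t)
    simp only [zero_mul, zero_add] at h
    refine h.congr' ?_
    filter_upwards [hpos] with n hn
    field_simp
    ring
  -- `dslope` extends the slope of log continuously to the base point, so that times with r (u n) =
  -- r t need no separate treatment.
  have hds : Tendsto (fun n => dslope Real.log (r t) (r (u n))) atTop (𝓝 (1 / r t)) := by
    have h := (continuousAt_dslope_same.2 (Real.differentiableAt_log hr0)).tendsto.comp hrt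
    simpa [Function.comp_def] using h
  have hlog : Tendsto (fun n => (u n - t)⁻¹ * (Real.log (r (u n)) - Real.log (r t))) atTop
      (𝓝 (r' / r t)) := by
    have h := hds.mul hr
    rw [one_div_mul_eq_div] at h
    refine h.congr fun n => ?_
    have := sub_smul_dslope Real.log (r t) (r (u n))
    rw [smul_eq_mul] at this
    rw [← this]
    ring
  have hlt : Tendsto (fun n => Real.log (r (u n))) atTop (𝓝 (Real.log (r t))) :=
    (Real.continuousAt_log hr0).tendsto.comp hrt
  refine ((hq.mul hlt).add (hlog.const_mul (q t))).congr fun n => ?_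
  ring

/-- If `u ≥ 0` has a right derivative at `t`, and `u * log u = o(s - t)`, `u t = 0`, then the
derivative vanishes. -/
theorem deriv_eq_zero_of_mul_log_isLittleO {u : ℝ → ℝ} {u' t : ℝ}
    (hu : HasDerivWithinAt u u' (Ici t) t) (h0 : u t = 0) (hn : ∀ᶠ s in 𝓝[>] t, 0 ≤ u s)
    (ho : (fun s => u s * Real.log (u s)) =o[𝓝[>] t] (fun s => s - t)) : u' = 0 := by
  have hc : Tendsto u (𝓝[>] t) (𝓝 0) := by
    have := hu.continuousWithinAt.tendsto
    rw [h0] at this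
    exact this.mono_left (nhdsWithin_mono _ Ioi_subset_Ici_self)
  -- Below exp(-1) one has |log u| ≥ 1, hence u ≤ |u log u|.
  have hlt : ∀ᶠ s in 𝓝[>] t, u s < Real.exp (-1) := hc.eventually (gt_mem_nhds (Real.exp_pos _))
  have hb : (fun s => u s - u t) =O[𝓝[>] t] (fun s => u s * Real.log (u s)) := by
    refine Asymptotics.IsBigO.of_bound 1 ?_
    filter_upwards [hlt, hn] with s h1 h2
    rw [h0, sub_zero, one_mul, norm_mul]
    rcases h2.eq_or_lt with h | h
    · simp [← h]
    · have : Real.log (u s) < -1 := by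
        rwa [Real.log_lt_iff_lt_exp h]
      have h3 : 1 ≤ ‖Real.log (u s)‖ := by
        rw [Real.norm_eq_abs, abs_of_neg (by linarith)]
        linarith
      nlinarith [norm_nonneg (u s)]
  have h2 := (hb.trans_isLittleO ho).tendsto_div_nhds_zero
  refine tendsto_nhds_unique (tendsto_slope_of_hasDerivWithinAt_Ici hu) (h2.congr fun s => ?_)
  rw [div_eq_inv_mul]

/-- The gradient of a differentiable function vanishes almost everywhere on its zero set. -/
theorem ae_fderiv_eq_zero_of_eq_zero {k : ℕ} {f : (Fin k → ℝ) → ℝ} (hf : Differentiable ℝ f) :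
    ∀ᵐ x, f x = 0 → fderiv ℝ f x = 0 := by
  rcases Nat.eq_zero_or_pos k with rfl | hk
  · filter_upwards with x _
    exact Subsingleton.elim _ _
  let v : Fin k → ℝ := Pi.single ⟨0, hk⟩ 1
  have hv : v ≠ 0 := by simp [v]
  -- On its zero set f is approximated by the zero map with constant 0, so its derivative is 0 at
  -- almost every point of that set. The factor v turns f into a self-map of the space, as
  -- `norm_fderiv_sub_le` requires.
  have happ : ApproximatesLinearOn (fun x => f x • v) (0 : (Fin k → ℝ) →L[ℝ] (Fin k → ℝ))
      {x | f x = 0} 0 := by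
    intro x hx y hy
    have hx0 : f x = 0 := hx
    have hy0 : f y = 0 := hy
    simp [hx0, hy0]
  have hs : MeasurableSet {x | f x = 0} := (isClosed_singleton.preimage hf.continuous).measurableSet
  have h := happ.norm_fderiv_sub_le volume hs (fun x => (fderiv ℝ f x).smulRight v)
    (fun x _ => ((hf x).hasFDerivAt.smul_const v).hasFDerivWithinAt)
  rw [ae_restrict_iff' hs] at h
  filter_upwards [h] with x hx h0
  have h1 := hx h0
  simp only [sub_zero, nonpos_iff_eq_zero, nnnorm_eq_zero] at h1
  ext w
  have h2 := DFunLike.congr_fun h1 w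
  simpa [hv] using h2

/-! ### Splitting off the first coordinate: Fubini and marginals. -/

section Fubini

variable {d : ℕ}

@[simp]
theorem others_cons (a : ℝ) (y : Fin d → ℝ) : others (Fin.cons a y : Fin (d + 1) → ℝ) = y := rfl

theorem cons_others (x : Fin (d + 1) → ℝ) : (Fin.cons (x 0) (others x) : Fin (d + 1) → ℝ) = x :=
  Fin.cons_self_tail x

theorem continuous_others : Continuous (others : (Fin (d + 1) → ℝ) → Fin d → ℝ) := by
  unfold others
  fun_prop

theorem continuous_cons :
    Continuous (fun z : ℝ × (Fin d → ℝ) => (Fin.cons z.1 z.2 : Fin (d + 1) → ℝ)) :=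
  continuous_pi fun i => Fin.cases (by simpa using continuous_fst)
    (fun j => by simpa using! (continuous_apply j).comp continuous_snd) i

theorem contDiff_others {n : WithTop ℕ∞} :
    ContDiff ℝ n (others : (Fin (d + 1) → ℝ) → Fin d → ℝ) := by
  unfold others
  fun_prop

theorem contDiff_cons {n : WithTop ℕ∞} :
    ContDiff ℝ n (fun z : ℝ × (Fin d → ℝ) => (Fin.cons z.1 z.2 : Fin (d + 1) → ℝ)) :=
  contDiff_pi.2 fun i => Fin.cases (by simpa using contDiff_fst)
    (fun j => by simpa using! (contDiff_apply ℝ ℝ j).comp contDiff_snd) i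

theorem measurePreserving_cons :
    MeasurePreserving (fun z : ℝ × (Fin d → ℝ) => (Fin.cons z.1 z.2 : Fin (d + 1) → ℝ)) := by
  have h := (volume_preserving_piFinSuccAbove (fun _ : Fin (d + 1) => ℝ) 0).symm
  convert h using 1
  ext z i
  simp [MeasurableEquiv.piFinSuccAbove]

theorem measurableEmbedding_cons :
    MeasurableEmbedding
      (fun z : ℝ × (Fin d → ℝ) => (Fin.cons z.1 z.2 : Fin (d + 1) → ℝ)) := by
  have h := (MeasurableEquiv.piFinSuccAbove (fun _ : Fin (d + 1) => ℝ) 0).symm.measurableEmbedding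
  convert h using 1
  ext z i
  simp [MeasurableEquiv.piFinSuccAbove]

theorem integrable_comp_cons {f : (Fin (d + 1) → ℝ) → ℝ} :
    Integrable (fun z : ℝ × (Fin d → ℝ) => f (Fin.cons z.1 z.2)) (volume.prod volume) ↔
      Integrable f :=
  measurePreserving_cons.integrable_comp_emb measurableEmbedding_cons

theorem integral_comp_cons (f : (Fin (d + 1) → ℝ) → ℝ) :
    ∫ z : ℝ × (Fin d → ℝ), f (Fin.cons z.1 z.2) ∂(volume.prod volume) = ∫ x, f x :=
  measurePreserving_cons.integral_comp measurableEmbedding_cons f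

theorem ae_integrable_cons {f : (Fin (d + 1) → ℝ) → ℝ} (hf : Integrable f) :
    ∀ᵐ y : Fin d → ℝ, Integrable (fun a : ℝ => f (Fin.cons a y)) :=
  (integrable_comp_cons.2 hf).prod_left_ae

theorem integrable_marginal {f : (Fin (d + 1) → ℝ) → ℝ} (hf : Integrable f) :
    Integrable (marginal f) :=
  (integrable_comp_cons.2 hf).integral_prod_right

theorem integral_marginal {f : (Fin (d + 1) → ℝ) → ℝ} (hf : Integrable f) :
    ∫ y, marginal f y = ∫ x, f x := by
  rw [← integral_comp_cons, integral_prod_symm _ (integrable_comp_cons.2 hf)]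
  rfl

theorem ae_ae_cons {p : (Fin (d + 1) → ℝ) → Prop} (h : ∀ᵐ x, p x) :
    ∀ᵐ y : Fin d → ℝ, ∀ᵐ a : ℝ, p (Fin.cons a y) := by
  have h1 : ∀ᵐ z : ℝ × (Fin d → ℝ), p (Fin.cons z.1 z.2) :=
    measurePreserving_cons.quasiMeasurePreserving.ae h
  have h2 : ∀ᵐ z : (Fin d → ℝ) × ℝ ∂(volume.prod volume), p (Fin.cons z.2 z.1) :=
    Measure.measurePreserving_swap.quasiMeasurePreserving.ae h1
  exact Measure.ae_ae_of_ae_prod h2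

/-- The exceptional null set may vary with a. Null slices give a null set only under measurability,
whence `hm`. -/
theorem ae_of_forall_ae_cons {p : (Fin (d + 1) → ℝ) → Prop} (hm : MeasurableSet {x | p x})
    (h : ∀ a : ℝ, ∀ᵐ y : Fin d → ℝ, p (Fin.cons a y)) : ∀ᵐ x, p x := by
  rw [← measurePreserving_cons.map_eq, ae_map_iff measurePreserving_cons.aemeasurable hm]
  exact (Measure.ae_prod_iff_ae_ae (measurePreserving_cons.measurable hm)).2 (ae_of_all _ h)

theorem measurable_marginal {f : (Fin (d + 1) → ℝ) → ℝ} (hf : Measurable f) :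
    Measurable (marginal f) := by
  have h : StronglyMeasurable (fun z : (Fin d → ℝ) × ℝ => f (Fin.cons z.2 z.1)) :=
    (hf.comp (continuous_cons.measurable.comp measurable_swap)).stronglyMeasurable
  exact h.integral_prod_right.measurable

theorem marginal_nonneg {f : (Fin (d + 1) → ℝ) → ℝ} (hf : ∀ x, 0 ≤ f x) (y : Fin d → ℝ) :
    0 ≤ marginal f y :=
  integral_nonneg fun _ => hf _

theorem marginal_mul_others (f : (Fin (d + 1) → ℝ) → ℝ) (h : (Fin d → ℝ) → ℝ) :
    marginal (fun x => f x * h (others x)) = fun y => marginal f y * h y := by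
  ext y
  exact integral_mul_const (h y) fun a : ℝ => f (Fin.cons a y)

/-- By Tonelli: as f ≥ 0, integrating the norm over the first coordinate gives the norm of the
marginal product. -/
theorem integrable_mul_others {f : (Fin (d + 1) → ℝ) → ℝ} {h : (Fin d → ℝ) → ℝ}
    (hf : Integrable f) (hf0 : ∀ x, 0 ≤ f x) (hh : Measurable h)
    (hfh : Integrable (fun y => marginal f y * h y)) :
    Integrable (fun x => f x * h (others x)) := by
  refine integrable_comp_cons.1 ((integrable_prod_iff' ?_).2 ⟨?_, ?_⟩)
  · exact ((integrable_comp_cons.2 hf).aestronglyMeasurable).mul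
      (hh.comp measurable_snd).aestronglyMeasurable
  · filter_upwards [ae_integrable_cons hf] with y hy
    exact hy.mul_const (h y)
  · refine hfh.norm.congr (ae_of_all _ fun y => ?_)
    simp only [others_cons, norm_mul, marginal]
    rw [integral_mul_const, Real.norm_of_nonneg (integral_nonneg fun _ => hf0 _)]
    congr 1
    exact integral_congr_ae (ae_of_all _ fun a => (Real.norm_of_nonneg (hf0 _)).symm)

end Fubini

/-! ### Expectations through densities. -/

section Density

variable {k : ℕ} {Ω : Type*} [MeasurableSpace Ω] {P : Measure Ω} {Z : Ω → Fin k → ℝ}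
  {p : (Fin k → ℝ) → ℝ}

theorem IsDensity.integral_comp (h : IsDensity P Z p) (hZ : Measurable Z) {g : (Fin k → ℝ) → ℝ}
    (hg : Measurable g) : ∫ ω, g (Z ω) ∂P = ∫ x, p x * g x := by
  rw [← integral_map hZ.aemeasurable hg.aestronglyMeasurable, h.map_eq,
    integral_withDensity_eq_integral_toReal_smul h.measurable.ennreal_ofReal
      (ae_of_all _ fun _ => ENNReal.ofReal_lt_top)]
  simp [ENNReal.toReal_ofReal (h.nonneg _)]

theorem IsDensity.integrable_comp_iff (h : IsDensity P Z p) (hZ : Measurable Z)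
    {g : (Fin k → ℝ) → ℝ} (hg : Measurable g) :
    Integrable (fun ω => g (Z ω)) P ↔ Integrable (fun x => p x * g x) := by
  have h1 := integrable_map_measure (μ := P) (f := Z) hg.aestronglyMeasurable hZ.aemeasurable
  rw [h.map_eq, integrable_withDensity_iff_integrable_smul' h.measurable.ennreal_ofReal
      (ae_of_all _ fun _ => ENNReal.ofReal_lt_top)] at h1
  simp only [ENNReal.toReal_ofReal (h.nonneg _), smul_eq_mul] at h1
  exact h1.symm

theorem IsDensity.integrable [IsProbabilityMeasure P] (h : IsDensity P Z p) (hZ : Measurable Z) :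
    Integrable p := by
  simpa using (h.integrable_comp_iff hZ (measurable_const (a := (1 : ℝ)))).1
    (integrable_const _)

theorem IsDensity.integral_eq_one [IsProbabilityMeasure P] (h : IsDensity P Z p)
    (hZ : Measurable Z) : ∫ x, p x = 1 := by
  simpa using (h.integral_comp hZ (measurable_const (a := (1 : ℝ)))).symm

theorem IsDensity.ae_eq (h : IsDensity P Z p) {p' : (Fin k → ℝ) → ℝ} (h' : IsDensity P Z p')
    [IsProbabilityMeasure P] (hZ : Measurable Z) :
    p =ᵐ[volume] p' := by
  have h1 := h.map_eq.symm.trans h'.map_eq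
  rw [withDensity_eq_iff h.measurable.ennreal_ofReal.aemeasurable
    h'.measurable.ennreal_ofReal.aemeasurable] at h1
  · filter_upwards [h1] with x hx
    rwa [ENNReal.ofReal_eq_ofReal_iff (h.nonneg x) (h'.nonneg x)] at hx
  · exact (h.integrable hZ).lintegral_lt_top.ne

end Density

/-! ### Partial derivatives and integration by parts. -/

section PartialDerivatives

variable {k d : ℕ}

theorem pd_eq_fderiv {f : (Fin k → ℝ) → ℝ} {x : Fin k → ℝ} (hf : DifferentiableAt ℝ f x)
    (i : Fin k) : pd i f x = fderiv ℝ f x (Pi.single i 1) :=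
  hf.lineDeriv_eq_fderiv

theorem contDiff_pd {f : (Fin k → ℝ) → ℝ} {m n : WithTop ℕ∞} (hf : ContDiff ℝ n f)
    (hmn : m + 1 ≤ n) (i : Fin k) : ContDiff ℝ m (pd i f) := by
  have h1 : pd i f = fun x => fderiv ℝ f x (Pi.single i 1) := by
    ext x
    exact pd_eq_fderiv ((hf.differentiable (fun h => by simp [h] at hmn)) x) i
  rw [h1]
  exact (hf.fderiv_right hmn).clm_apply contDiff_const

theorem pd_congr {f g : (Fin k → ℝ) → ℝ} {x : Fin k → ℝ} (h : f =ᶠ[𝓝 x] g)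
    (i : Fin k) : pd i f x = pd i g x :=
  h.lineDeriv_eq

theorem hasCompactSupport_pd {f : (Fin k → ℝ) → ℝ} (hf : HasCompactSupport f) (i : Fin k) :
    HasCompactSupport (pd i f) := by
  refine hf.of_isClosed_subset (isClosed_tsupport _) (closure_minimal ?_ (isClosed_tsupport _))
  intro x hx
  by_contra hxs
  have h0 : f =ᶠ[𝓝 x] fun _ => 0 := notMem_tsupport_iff_eventuallyEq.1 hxs
  exact hx (by rw [pd_congr h0]; simp [pd, lineDeriv])

theorem pd_const_mul (i : Fin k) (c : ℝ) (f : (Fin k → ℝ) → ℝ) (x : Fin k → ℝ) :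
    pd i (fun z => c * f z) x = c * pd i f x := by
  simp [pd, lineDeriv]

/-- The line through x in direction `i.succ` stays in the slice of constant first coordinate, so no
differentiability is needed. -/
theorem pd_succ (i : Fin d) (f : (Fin (d + 1) → ℝ) → ℝ) (x : Fin (d + 1) → ℝ) :
    pd i.succ f x = pd i (fun y => f (Fin.cons (x 0) y)) (others x) := by
  unfold pd lineDeriv
  congr 1
  ext h
  congr 1
  ext j
  refine Fin.cases ?_ (fun l => ?_) j
  · simp
  · simp [Pi.single_apply, others, Fin.succ_inj]

theorem pd_zero_comp_others (f : (Fin d → ℝ) → ℝ) (x : Fin (d + 1) → ℝ) :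
    pd 0 (fun z => f (others z)) x = 0 := by
  have : ∀ h : ℝ, others (x + h • (Pi.single 0 1 : Fin (d + 1) → ℝ)) = others x := by
    intro h
    ext l
    simp [others]
  simp [pd, lineDeriv, this]

theorem integral_mul_pd {f g : (Fin k → ℝ) → ℝ} (hf : ContDiff ℝ 1 f) (hg : ContDiff ℝ 1 g)
    (hfs : HasCompactSupport f) (i : Fin k) :
    ∫ x, f x * pd i g x = -∫ x, pd i f x * g x := by
  have hfd := hf.differentiable one_ne_zero
  have hgd := hg.differentiable one_ne_zero
  have hcf := (contDiff_pd (m := 0) hf (by simp) i).continuous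
  have hcg := (contDiff_pd (m := 0) hg (by simp) i).continuous
  simp only [funext fun x => pd_eq_fderiv (hfd x) i, funext fun x => pd_eq_fderiv (hgd x) i]
    at hcf hcg ⊢
  refine integral_mul_fderiv_eq_neg_fderiv_mul_of_integrable ?_ ?_ ?_ (fun x _ => hfd x)
    (fun x _ => hgd x)
  · refine (hcf.mul hg.continuous).integrable_of_hasCompactSupport (HasCompactSupport.mul_right ?_)
    simpa only [funext fun x => pd_eq_fderiv (hfd x) i] using hasCompactSupport_pd hfs i
  · exact (hf.continuous.mul hcg).integrable_of_hasCompactSupport hfs.mul_right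
  · exact (hf.continuous.mul hg.continuous).integrable_of_hasCompactSupport hfs.mul_right

theorem integral_pd {f : (Fin k → ℝ) → ℝ} (hf : ContDiff ℝ 1 f) (hfs : HasCompactSupport f)
    (i : Fin k) : ∫ x, pd i f x = 0 := by
  have h := integral_mul_pd hf (contDiff_const (c := (1 : ℝ))) hfs i
  simpa [pd, lineDeriv] using h

end PartialDerivatives

/-! ### Smoothness and compact support of marginals. -/

section Marginal

variable {d : ℕ}

theorem hasCompactSupport_marginal {f : (Fin (d + 1) → ℝ) → ℝ} (hf : HasCompactSupport f) :
    HasCompactSupport (marginal f) := by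
  refine HasCompactSupport.intro (hf.isCompact.image continuous_others) fun y hy => ?_
  have : ∀ a : ℝ, f (Fin.cons a y) = 0 := by
    intro a
    by_contra h
    exact hy ⟨_, subset_tsupport _ h, rfl⟩
  simp [marginal, this]

theorem contDiff_marginal {f : (Fin (d + 1) → ℝ) → ℝ} {n : ℕ∞} (hf : ContDiff ℝ n f)
    (hfs : HasCompactSupport f) : ContDiff ℝ n (marginal f) := by
  have hk : IsCompact ((fun x : Fin (d + 1) → ℝ => -x 0) '' tsupport f) :=
    hfs.isCompact.image (by fun_prop)
  -- The marginal at y is the convolution of the constant 1 with a ↦ f(-a, y), evaluated at 0; the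
  -- sign undoes the reflection in the convolution.
  have h := contDiffOn_convolution_right_with_param (μ := (volume : Measure ℝ)) (n := n)
    (f := fun _ : ℝ => (1 : ℝ)) (ContinuousLinearMap.mul ℝ ℝ)
    (g := fun (y : Fin d → ℝ) a => f (Fin.cons (-a) y)) (s := univ) isOpen_univ hk ?_
    (locallyIntegrable_const _) ?_
  · rw [univ_prod_univ, contDiffOn_univ] at h
    have h2 := h.comp (contDiff_id.prodMk (contDiff_const (c := (0 : ℝ))))
    convert h2 using 1
    ext y
    simp [convolution, marginal]
  · intro y a _ ha
    by_contra h0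
    exact ha ⟨_, subset_tsupport _ h0, by simp⟩
  · refine ContDiff.contDiffOn ?_
    exact hf.comp (contDiff_cons.comp ((contDiff_snd.neg).prodMk contDiff_fst))

end Marginal

/-! ### Continuity, locality and boundedness of the generator. -/

section Generator

variable {k m : ℕ} {F : ℝ → (Fin k → ℝ) → Fin k → ℝ}
  {B : ℝ → (Fin k → ℝ) → Matrix (Fin k) (Fin m) ℝ} {φ : (Fin k → ℝ) → ℝ}

theorem continuous_generator (hF : Continuous (fun z : ℝ × (Fin k → ℝ) => F z.1 z.2))
    (hB : Continuous (fun z : ℝ × (Fin k → ℝ) => B z.1 z.2)) (hφ : ContDiff ℝ 2 φ) :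
    Continuous (fun z : ℝ × (Fin k → ℝ) => generator F B z.1 φ z.2) := by
  have h1 : ∀ i, Continuous (fun z : ℝ × (Fin k → ℝ) => pd i φ z.2) := fun i =>
    (contDiff_pd (m := 1) hφ (by norm_num) i).continuous.comp continuous_snd
  have h2 : ∀ i j, Continuous (fun z : ℝ × (Fin k → ℝ) => pd i (fun w => pd j φ w) z.2) :=
    fun i j => (contDiff_pd (m := 0) (contDiff_pd (m := 1) hφ (by norm_num) j)
      (by simp) i).continuous.comp continuous_snd
  have h3 : ∀ i, Continuous (fun z : ℝ × (Fin k → ℝ) => F z.1 z.2 i) := fun i =>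
    (continuous_apply i).comp hF
  have h4 : ∀ i l, Continuous (fun z : ℝ × (Fin k → ℝ) => B z.1 z.2 i l) := fun i l =>
    hB.matrix_elem i l
  unfold generator gMat
  fun_prop

theorem generator_congr {ψ : (Fin k → ℝ) → ℝ} {x : Fin k → ℝ} (s : ℝ) (h : φ =ᶠ[𝓝 x] ψ) :
    generator F B s φ x = generator F B s ψ x := by
  have h2 : ∀ j, (fun z => pd j φ z) =ᶠ[𝓝 x] (fun z => pd j ψ z) := fun j =>
    h.eventuallyEq_nhds.mono fun z hz => pd_congr hz j
  unfold generator
  simp only [pd_congr h, fun i j => pd_congr (h2 j) i]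

theorem generator_zero (s : ℝ) (x : Fin k → ℝ) : generator F B s (fun _ => 0) x = 0 := by
  simp [generator, pd, lineDeriv]

/-- The generator is local, so it vanishes off the support of φ; on the compact product of the time
interval and the support it is continuous. -/
theorem exists_bound_generator (hF : Continuous (fun z : ℝ × (Fin k → ℝ) => F z.1 z.2))
    (hB : Continuous (fun z : ℝ × (Fin k → ℝ) => B z.1 z.2)) (hφ : ContDiff ℝ 2 φ)
    (hφs : HasCompactSupport φ) (t t₁ : ℝ) :
    ∃ C, ∀ s ∈ Icc t t₁, ∀ x, ‖generator F B s φ x‖ ≤ C := by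
  obtain ⟨C, hC⟩ := (isCompact_Icc.prod hφs.isCompact).exists_bound_of_continuousOn
    (s := Icc t t₁ ×ˢ tsupport φ) (continuous_generator hF hB hφ).continuousOn
  refine ⟨max C 0, fun s hs x => ?_⟩
  by_cases hx : x ∈ tsupport φ
  · exact (hC (s, x) ⟨hs, hx⟩).trans (le_max_left _ _)
  · rw [generator_congr s (notMem_tsupport_iff_eventuallyEq.1 hx)]
    simp [show (0 : (Fin k → ℝ) → ℝ) = fun _ => 0 from rfl, generator_zero]

end Generator

/-! ### Dynkin's formula and the weak Fokker-Planck equation. -/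

section Solution

variable {k m : ℕ} {F : ℝ → (Fin k → ℝ) → Fin k → ℝ}
  {B : ℝ → (Fin k → ℝ) → Matrix (Fin k) (Fin m) ℝ} {t t₁ : ℝ}
  {Ω : Type*} [MeasurableSpace Ω] {P : Measure Ω} {Z : ℝ → Ω → Fin k → ℝ}

theorem IsSolution.measurable (h : IsSolution F B t t₁ P Z) {s : ℝ} (hs : s ∈ Icc t t₁) :
    Measurable (Z s) := by
  obtain ⟨ℱ, had, -⟩ := h.martingale
  exact (had ⟨s, hs⟩).mono (ℱ.le _) le_rfl

/-- **Dynkin's formula**, differentiated at the initial time. -/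
theorem IsSolution.hasDerivWithinAt_integral [IsProbabilityMeasure P]
    (h : IsSolution F B t t₁ P Z) (ht : t < t₁)
    (hF : Continuous (fun z : ℝ × (Fin k → ℝ) => F z.1 z.2))
    (hB : Continuous (fun z : ℝ × (Fin k → ℝ) => B z.1 z.2)) {φ : (Fin k → ℝ) → ℝ}
    (hφ : ContDiff ℝ ((⊤ : ℕ∞) : WithTop ℕ∞) φ) (hφs : HasCompactSupport φ) :
    HasDerivWithinAt (fun s => ∫ ω, φ (Z s ω) ∂P) (∫ ω, generator F B t φ (Z t ω) ∂P)
      (Ici t) t := by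
  have hφ2 : ContDiff ℝ 2 φ := contDiff_infty.1 hφ 2
  have hg := continuous_generator hF hB hφ2
  obtain ⟨C, hC⟩ := exists_bound_generator hF hB hφ2 hφs t t₁
  obtain ⟨ℱ, had, hmart⟩ := h.martingale
  have hM := hmart φ hφ hφs
  have htm : t ∈ Icc t t₁ := left_mem_Icc.2 ht.le
  have hφi : ∀ s ∈ Icc t t₁, Integrable (fun ω => φ (Z s ω)) P := by
    obtain ⟨D, hD⟩ := hφ.continuous.bounded_above_of_compact_support hφs
    intro s hs
    exact Integrable.of_bound ((hφ.continuous.measurable.comp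
      (h.measurable hs)).aestronglyMeasurable) D (ae_of_all _ fun ω => hD _)
  -- The time integral is a difference of two integrable variables, φ(Z_s) and the martingale, so
  -- joint measurability in (r, ω) is not needed.
  have hIi : ∀ s ∈ Icc t t₁,
      Integrable (fun ω => ∫ r in t..s, generator F B r φ (Z r ω)) P := by
    intro s hs
    refine ((hφi s hs).sub (hM.integrable ⟨s, hs⟩)).congr (ae_of_all _ fun ω => ?_)
    simp
  have hE : ∀ s ∈ Icc t t₁, ∫ ω, φ (Z s ω) ∂P =
      ∫ ω, φ (Z t ω) ∂P + ∫ ω, (∫ r in t..s, generator F B r φ (Z r ω)) ∂P := by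
    intro s hs
    have h1 : ∫ ω, (φ (Z s ω) - ∫ r in t..s, generator F B r φ (Z r ω)) ∂P =
        ∫ ω, (φ (Z t ω) - ∫ r in t..t, generator F B r φ (Z r ω)) ∂P := by
      have h2 := integral_congr_ae (hM.2 ⟨t, htm⟩ ⟨s, hs⟩ hs.1)
      rw [integral_condExp (ℱ.le _)] at h2
      exact h2
    rw [integral_sub (hφi s hs) (hIi s hs)] at h1
    simp only [intervalIntegral.integral_same, sub_zero] at h1
    linarith
  have hcont : ∀ ω, ContinuousOn (fun r => generator F B r φ (Z r ω)) (Icc t t₁) := fun ω =>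
    hg.comp_continuousOn (continuousOn_id.prodMk (h.continuous_paths ω))
  have hA := hasDerivWithinAt_integral_of_dominated_slopes (μ := P)
    (f := fun s ω => ∫ r in t..s, generator F B r φ (Z r ω))
    (f' := fun ω => generator F B t φ (Z t ω)) (G := fun _ => C) ht
    (fun s hs => (hIi s hs).aestronglyMeasurable) (hIi t htm) (integrable_const _)
    (ae_of_all _ fun ω s hs => ?_) (fun u hu => ae_of_all _ fun ω => ?_)
  · refine (hA.2.const_add (∫ ω, φ (Z t ω) ∂P)).congr_of_eventuallyEq ?_ (hE t htm)
    filter_upwards [Icc_mem_nhdsGE ht] with s hs using hE s hs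
  · simp only [intervalIntegral.integral_same, sub_zero]
    have h1 := intervalIntegral.norm_integral_le_of_norm_le_const (a := t) (b := s) (C := C)
      (f := fun r => generator F B r φ (Z r ω)) (fun r hr => ?_)
    · rwa [abs_of_pos (sub_pos.2 hs.1), Real.norm_eq_abs, mul_comm] at h1
    · rw [uIoc_of_le hs.1.le] at hr
      exact hC r ⟨hr.1.le, hr.2.trans hs.2.le⟩ _
  · have h1 : HasDerivWithinAt (fun s => ∫ r in t..s, generator F B r φ (Z r ω))
        (generator F B t φ (Z t ω)) (Ici t) t := by
      refine intervalIntegral.integral_hasDerivWithinAt_right (by simp) (t := Ioi t) ?_ ?_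
      · refine ⟨Ioc t t₁, Ioc_mem_nhdsGT ht, ?_⟩
        exact ((hcont ω).mono Ioc_subset_Icc_self).aestronglyMeasurable measurableSet_Ioc
      · refine ((hcont ω).continuousWithinAt htm).mono_of_mem_nhdsWithin ?_
        exact mem_of_superset (Ioc_mem_nhdsGT ht) Ioc_subset_Icc_self
    exact (tendsto_slope_of_hasDerivWithinAt_Ici h1).comp hu

/-- The weak form of the Fokker-Planck equation at the initial time. -/
theorem IsSolution.integral_mul_deriv_density [IsProbabilityMeasure P]
    (h : IsSolution F B t t₁ P Z) (ht : t < t₁)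
    (hF : Continuous (fun z : ℝ × (Fin k → ℝ) => F z.1 z.2))
    (hB : Continuous (fun z : ℝ × (Fin k → ℝ) => B z.1 z.2)) {p : ℝ → (Fin k → ℝ) → ℝ}
    (hp : ∀ s ∈ Icc t t₁, IsDensity P (Z s) (p s)) (hreg : RightDiffDominated p t t₁) :
    Integrable (fun x => derivWithin (fun s => p s x) (Ici t) t) ∧
    ∀ φ : (Fin k → ℝ) → ℝ, ContDiff ℝ ((⊤ : ℕ∞) : WithTop ℕ∞) φ → HasCompactSupport φ →
      ∫ x, φ x * derivWithin (fun s => p s x) (Ici t) t =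
        ∫ x, p t x * generator F B t φ x := by
  have htm : t ∈ Icc t t₁ := left_mem_Icc.2 ht.le
  obtain ⟨hd, G, hG, hdom⟩ := hreg
  have hpi := (hp t htm).integrable (h.measurable htm)
  have hslope : ∀ u : ℕ → ℝ, Tendsto u atTop (𝓝[>] t) → ∀ᵐ x,
      Tendsto (fun n => (u n - t)⁻¹ * (p (u n) x - p t x)) atTop
        (𝓝 (derivWithin (fun s => p s x) (Ici t) t)) := by
    intro u hu
    filter_upwards [hd] with x hx
    exact (tendsto_slope_of_hasDerivWithinAt_Ici hx.hasDerivWithinAt).comp hu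
  refine ⟨(hasDerivWithinAt_integral_of_dominated_slopes ht
    (fun s hs => (hp s hs).measurable.aestronglyMeasurable) hpi hG hdom hslope).1, ?_⟩
  intro φ hφ hφs
  have hφm := hφ.continuous.measurable
  obtain ⟨D, hD⟩ := hφ.continuous.bounded_above_of_compact_support hφs
  have hA := hasDerivWithinAt_integral_of_dominated_slopes (μ := volume)
    (f := fun s x => φ x * p s x) (G := fun x => D * G x) ht
    (fun s hs => (hφm.mul (hp s hs).measurable).aestronglyMeasurable)
    (hpi.bdd_mul (c := D) hφm.aestronglyMeasurable (ae_of_all _ hD)) (hG.const_mul D) ?_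
    (f' := fun x => φ x * derivWithin (fun s => p s x) (Ici t) t) ?_
  · have h1 := h.hasDerivWithinAt_integral ht hF hB hφ hφs
    have h2 : HasDerivWithinAt (fun s => ∫ ω, φ (Z s ω) ∂P)
        (∫ x, φ x * derivWithin (fun s => p s x) (Ici t) t) (Ici t) t := by
      have h3 : ∀ s ∈ Icc t t₁, ∫ ω, φ (Z s ω) ∂P = ∫ x, φ x * p s x := fun s hs => by
        rw [(hp s hs).integral_comp (h.measurable hs) hφm]
        simp only [mul_comm]
      refine hA.2.congr_of_eventuallyEq ?_ (h3 t htm)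
      filter_upwards [Icc_mem_nhdsGE ht] with s hs using h3 s hs
    have hφ2 : ContDiff ℝ 2 φ := contDiff_infty.1 hφ 2
    -- Two expressions for the right derivative of E[φ(Z_s)]: one through the density, one by
    -- Dynkin's formula.
    rw [(uniqueDiffWithinAt_Ici t).eq_deriv _ h2 h1, (hp t htm).integral_comp (h.measurable htm)]
    exact ((continuous_generator hF hB hφ2).comp (continuous_const.prodMk continuous_id)).measurable
  · filter_upwards [hdom] with x hx s hs
    rw [← mul_sub, abs_mul]
    calc |φ x| * |p s x - p t x| ≤ D * ((s - t) * G x) :=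
          mul_le_mul (hD x) (hx s hs) (abs_nonneg _) ((norm_nonneg _).trans (hD x))
      _ = (s - t) * (D * G x) := by ring
  · intro u hu
    filter_upwards [hslope u hu] with x hx
    refine (hx.const_mul (φ x)).congr fun n => ?_
    ring

end Solution

/-! ### Freezing the first component does not affect the marginal rate of change. -/

section Others

variable {d m : ℕ} {F : ℝ → (Fin (d + 1) → ℝ) → Fin (d + 1) → ℝ}
  {B : ℝ → (Fin (d + 1) → ℝ) → Matrix (Fin (d + 1)) (Fin m) ℝ}

/-- On functions of the other components, the generators of the original and of the modified
system agree. -/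
theorem generator_comp_others (s : ℝ) (φ : (Fin d → ℝ) → ℝ) (x : Fin (d + 1) → ℝ) :
    generator F B s (fun z => φ (others z)) x =
      generator (stopDrift F) (stopNoise B) s (fun z => φ (others z)) x := by
  have h1 : ∀ j : Fin d, (fun z : Fin (d + 1) → ℝ => pd j.succ (fun w => φ (others w)) z) =
      fun z => pd j φ (others z) := by
    intro j
    ext z
    simp [pd_succ]
  have h3 : ∀ (i : Fin (d + 1)) x, pd i (fun _ : Fin (d + 1) → ℝ => (0 : ℝ)) x = 0 := by
    intro i x
    simp [pd, lineDeriv]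
  simp only [generator, Fin.sum_univ_succ, h1, h3, pd_zero_comp_others]
  simp [stopDrift, stopNoise, gMat]

/-- The natural test functions φ(others x) are not compactly supported in x_1, so they are
multiplied by cutoffs in x_1. On the generator side a large cutoff is invisible, since p₀ has
compact support, and there the two generators agree; on the other side it is removed by dominated
convergence. -/
theorem ae_eq_marginal_of_integral_mul_eq {f g p₀ p₁ : (Fin (d + 1) → ℝ) → ℝ} {t : ℝ}
    (hf : Integrable f) (hg : Integrable g) (hp : p₀ =ᵐ[volume] p₁) (hp₀ : HasCompactSupport p₀)
    (hfw : ∀ φ : (Fin (d + 1) → ℝ) → ℝ, ContDiff ℝ ((⊤ : ℕ∞) : WithTop ℕ∞) φ →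
      HasCompactSupport φ → ∫ x, φ x * f x = ∫ x, p₀ x * generator F B t φ x)
    (hgw : ∀ φ : (Fin (d + 1) → ℝ) → ℝ, ContDiff ℝ ((⊤ : ℕ∞) : WithTop ℕ∞) φ →
      HasCompactSupport φ →
      ∫ x, φ x * g x = ∫ x, p₁ x * generator (stopDrift F) (stopNoise B) t φ x) :
    marginal f =ᵐ[volume] marginal g := by
  refine ae_eq_of_integral_contDiff_smul_eq (integrable_marginal hf).locallyIntegrable
    (integrable_marginal hg).locallyIntegrable fun φ hφ hφs => ?_
  obtain ⟨D, hD⟩ := hφ.continuous.bounded_above_of_compact_support hφs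
  let χ : ∀ _ : ℕ, ContDiffBump (0 : ℝ) := fun n =>
    { rIn := n + 1, rOut := n + 2, rIn_pos := by positivity, rIn_lt_rOut := by linarith }
  let Φ : ℕ → (Fin (d + 1) → ℝ) → ℝ := fun n x => χ n (x 0) * φ (others x)
  have hΦ : ∀ n, ContDiff ℝ ((⊤ : ℕ∞) : WithTop ℕ∞) (Φ n) := fun n =>
    ((χ n).contDiff.comp (contDiff_apply ℝ ℝ 0)).mul (hφ.comp contDiff_others)
  have hΦs : ∀ n, HasCompactSupport (Φ n) := by
    intro n
    refine HasCompactSupport.intro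
      (((χ n).hasCompactSupport.isCompact.prod hφs.isCompact).image continuous_cons) ?_
    intro x hx
    by_contra h0
    refine hx ⟨(x 0, others x), ⟨subset_tsupport _ (left_ne_zero_of_mul h0),
      subset_tsupport _ (right_ne_zero_of_mul h0)⟩, cons_others x⟩
  have hΦ1 : ∀ (n : ℕ) (x : Fin (d + 1) → ℝ), |x 0| ≤ n + 1 → Φ n x = φ (others x) := by
    intro n x hx
    have : χ n (x 0) = 1 := (χ n).one_of_mem_closedBall (by simpa using hx)
    simp [Φ, this]
  have hlim : ∀ h : (Fin (d + 1) → ℝ) → ℝ, Integrable h →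
      Tendsto (fun n => ∫ x, Φ n x * h x) atTop (𝓝 (∫ y, φ y • marginal h y)) := by
    intro h hh
    have hi : Integrable (fun x => φ (others x) * h x) :=
      hh.bdd_mul (c := D) (hφ.continuous.comp continuous_others).aestronglyMeasurable
        (ae_of_all _ fun x => hD _)
    have h1 : ∫ y, φ y • marginal h y = ∫ x, φ (others x) * h x := by
      rw [← integral_marginal hi]
      simp only [mul_comm (φ _), marginal_mul_others, smul_eq_mul]
    rw [h1]
    refine tendsto_integral_of_dominated_convergence (fun x => D * ‖h x‖)
      (fun n => (hΦ n).continuous.aestronglyMeasurable.mul hh.aestronglyMeasurable)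
      (hh.norm.const_mul D) (fun n => ae_of_all _ fun x => ?_) (ae_of_all _ fun x => ?_)
    · rw [norm_mul]
      refine mul_le_mul_of_nonneg_right ?_ (norm_nonneg _)
      rw [norm_mul, Real.norm_of_nonneg (χ n).nonneg]
      exact (mul_le_of_le_one_left (norm_nonneg _) (χ n).le_one).trans (hD _)
    · refine tendsto_const_nhds.congr' ?_
      filter_upwards [tendsto_natCast_atTop_atTop.eventually_ge_atTop |x 0|] with n hn
      rw [hΦ1 n x (by linarith)]
  obtain ⟨R, hR⟩ := hp₀.isCompact.exists_bound_of_continuousOn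
    (f := fun x : Fin (d + 1) → ℝ => x 0) (by fun_prop)
  refine tendsto_nhds_unique (hlim f hf) ((hlim g hg).congr' ?_)
  filter_upwards [tendsto_natCast_atTop_atTop.eventually_ge_atTop R] with n hn
  rw [hfw _ (hΦ n) (hΦs n), hgw _ (hΦ n) (hΦs n)]
  refine integral_congr_ae ?_
  filter_upwards [hp] with x hx
  rw [← hx]
  by_cases h0 : p₀ x = 0
  · simp [h0]
  -- The strict inequality makes the cutoff equal to 1 on a whole neighbourhood of x, as the
  -- derivatives in the generator require.
  have hx0 : |x 0| < n + 1 :=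
    lt_of_le_of_lt (hR x (subset_tsupport _ h0)) (by linarith)
  have hev : Φ n =ᶠ[𝓝 x] fun z => φ (others z) := by
    have : ∀ᶠ z : Fin (d + 1) → ℝ in 𝓝 x, |z 0| < n + 1 :=
      ((continuous_apply 0).abs.tendsto x).eventually (gt_mem_nhds hx0)
    filter_upwards [this] with z hz using hΦ1 n z hz.le
  rw [generator_congr t hev, generator_congr t hev,
    generator_comp_others (F := F) (B := B)]

end Others

/-! ### The pointwise Fokker-Planck equation for additive noise. -/

section FokkerPlanck

variable {k m : ℕ} {F : ℝ → (Fin k → ℝ) → Fin k → ℝ}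
  {B : ℝ → (Fin k → ℝ) → Matrix (Fin k) (Fin m) ℝ} {t t₁ : ℝ}

/-- Integration by parts: the adjoint of the generator when the noise is additive. -/
theorem integral_mul_generator {p φ : (Fin k → ℝ) → ℝ}
    (hF : ∀ i, ContDiff ℝ 1 fun x => F t x i) (hB : ∀ x x', B t x = B t x')
    (hp : ContDiff ℝ 2 p) (hps : HasCompactSupport p) (hφ : ContDiff ℝ 2 φ) :
    ∫ x, p x * generator F B t φ x =
      ∫ x, φ x * (-(∑ i, pd i (fun z => F t z i * p z) x) +
        (1 / 2) * ∑ i, ∑ j, gMat B t 0 i j * pd i (fun z => pd j p z) x) := by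
  have hp1 : ContDiff ℝ 1 p := hp.of_le one_le_two
  have hφ1 : ContDiff ℝ 1 φ := hφ.of_le one_le_two
  have hFp : ∀ i, ContDiff ℝ 1 fun z => F t z i * p z := fun i => (hF i).mul hp1
  have hFps : ∀ i, HasCompactSupport fun z => F t z i * p z := fun i => hps.mul_left
  have hpd : ∀ {f : (Fin k → ℝ) → ℝ}, ContDiff ℝ 2 f → ∀ j, ContDiff ℝ 1 fun z => pd j f z :=
    fun hf j => contDiff_pd hf (by norm_num) j
  have hpc : ∀ {f : (Fin k → ℝ) → ℝ}, ContDiff ℝ 1 f → ∀ i, Continuous fun z => pd i f z :=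
    fun hf i => (contDiff_pd (m := 0) hf (by simp) i).continuous
  have hg : ∀ x i j, gMat B t x i j = gMat B t 0 i j := fun x i j => by simp [gMat, hB x 0]
  have hgs : ∀ i j, gMat B t 0 i j = gMat B t 0 j i := fun i j => by simp [gMat, mul_comm]
  have i1 : ∀ i, Integrable fun x => (F t x i * p x) * pd i φ x := fun i =>
    ((hFp i).continuous.mul (hpc hφ1 i)).integrable_of_hasCompactSupport (hFps i).mul_right
  have i2 : ∀ i j, Integrable fun x => p x * pd i (fun z => pd j φ z) x := fun i j =>
    (hp.continuous.mul (hpc (hpd hφ j) i)).integrable_of_hasCompactSupport hps.mul_right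
  have i3 : ∀ i, Integrable fun x => pd i (fun z => F t z i * p z) x * φ x := fun i =>
    ((hpc (hFp i) i).mul hφ.continuous).integrable_of_hasCompactSupport
      (hasCompactSupport_pd (hFps i) i).mul_right
  have i4 : ∀ i j, Integrable fun x => pd i (fun z => pd j p z) x * φ x := fun i j =>
    ((hpc (hpd hp j) i).mul hφ.continuous).integrable_of_hasCompactSupport
      (hasCompactSupport_pd (hasCompactSupport_pd hps j) i).mul_right
  have i5 : Integrable fun x => -(∑ i, pd i (fun z => F t z i * p z) x * φ x) :=
    (integrable_finsetSum _ fun i _ => i3 i).neg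
  have e1 : ∀ x, p x * generator F B t φ x = ∑ i, (F t x i * p x) * pd i φ x +
      (1 / 2) * ∑ i, ∑ j, gMat B t 0 i j * (p x * pd i (fun z => pd j φ z) x) := by
    intro x
    simp only [generator, hg, mul_add, Finset.mul_sum]
    congr 1
    · exact Finset.sum_congr rfl fun i _ => by ring
    · exact Finset.sum_congr rfl fun i _ => Finset.sum_congr rfl fun j _ => by ring
  have e2 : ∀ x, φ x * (-(∑ i, pd i (fun z => F t z i * p z) x) +
      (1 / 2) * ∑ i, ∑ j, gMat B t 0 i j * pd i (fun z => pd j p z) x) =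
      -(∑ i, pd i (fun z => F t z i * p z) x * φ x) +
      (1 / 2) * ∑ i, ∑ j, gMat B t 0 i j * (pd i (fun z => pd j p z) x * φ x) := by
    intro x
    simp only [mul_add, mul_neg, Finset.mul_sum]
    congr 1
    · exact congrArg Neg.neg (Finset.sum_congr rfl fun i _ => by ring)
    · exact Finset.sum_congr rfl fun i _ => Finset.sum_congr rfl fun j _ => by ring
  -- The two integrations by parts reverse the order of i and j. Swapping the sums and the symmetry
  -- of g restore it at the end, without symmetry of second derivatives.
  have hibp : ∀ i j, ∫ x, p x * pd i (fun z => pd j φ z) x =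
      ∫ x, pd j (fun z => pd i p z) x * φ x := by
    intro i j
    rw [integral_mul_pd hp1 (hpd hφ j) hps i,
      integral_mul_pd (f := fun z => pd i p z) (hpd hp i) hφ1 (hasCompactSupport_pd hps i) j,
      neg_neg]
  simp only [e1, e2]
  rw [integral_add (integrable_finsetSum _ fun i _ => i1 i)
      ((integrable_finsetSum _ fun i _ => integrable_finsetSum _ fun j _ =>
        (i2 i j).const_mul _).const_mul _),
    integral_add i5
      ((integrable_finsetSum _ fun i _ => integrable_finsetSum _ fun j _ =>
        (i4 i j).const_mul _).const_mul _),
    integral_neg, integral_const_mul, integral_const_mul,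
    integral_finsetSum _ fun i _ => i1 i, integral_finsetSum _ fun i _ => i3 i,
    integral_finsetSum _ fun i _ => integrable_finsetSum _ fun j _ => (i2 i j).const_mul _,
    integral_finsetSum _ fun i _ => integrable_finsetSum _ fun j _ => (i4 i j).const_mul _]
  simp only [integral_finsetSum _ fun j _ => (i2 _ j).const_mul _,
    integral_finsetSum _ fun j _ => (i4 _ j).const_mul _, integral_const_mul, hibp,
    integral_mul_pd (hFp _) hφ1 (hFps _), Finset.sum_neg_distrib]
  rw [Finset.sum_comm]
  simp only [hgs]

/-- The Fokker-Planck equation at the initial time, for additive noise. -/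
theorem IsSolution.derivWithin_density_ae_eq {Ω : Type*} [MeasurableSpace Ω] {P : Measure Ω}
    [IsProbabilityMeasure P] {Z : ℝ → Ω → Fin k → ℝ} (h : IsSolution F B t t₁ P Z) (ht : t < t₁)
    (hF : Continuous (fun z : ℝ × (Fin k → ℝ) => F z.1 z.2))
    (hB : Continuous (fun z : ℝ × (Fin k → ℝ) => B z.1 z.2))
    (hFt : ∀ i, ContDiff ℝ 1 fun x => F t x i) (hBt : ∀ x x', B t x = B t x')
    {p : ℝ → (Fin k → ℝ) → ℝ} (hp : ∀ s ∈ Icc t t₁, IsDensity P (Z s) (p s))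
    (hpt : ContDiff ℝ 2 (p t)) (hps : HasCompactSupport (p t))
    (hreg : RightDiffDominated p t t₁) :
    ∀ᵐ x, derivWithin (fun s => p s x) (Ici t) t =
      -(∑ i, pd i (fun z => F t z i * p t z) x) +
        (1 / 2) * ∑ i, ∑ j, gMat B t 0 i j * pd i (fun z => pd j (p t) z) x := by
  obtain ⟨hi, hw⟩ := h.integral_mul_deriv_density ht hF hB hp hreg
  have hc1 : ∀ i, Continuous fun x => pd i (fun z => F t z i * p t z) x := fun i =>
    (contDiff_pd (m := 0) ((hFt i).mul (hpt.of_le one_le_two)) (by simp) i).continuous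
  have hc2 : ∀ i j, Continuous fun x => pd i (fun z => pd j (p t) z) x := fun i j =>
    (contDiff_pd (m := 0) (contDiff_pd (m := 1) hpt (by norm_num) j) (by simp) i).continuous
  refine ae_eq_of_integral_contDiff_smul_eq hi.locallyIntegrable
    (Continuous.locallyIntegrable (by fun_prop)) fun φ hφ hφs => ?_
  simp only [smul_eq_mul]
  rw [hw φ hφ hφs, integral_mul_generator hFt hBt hpt hps (contDiff_infty.1 hφ 2)]

end FokkerPlanck

/-! ### Right derivatives of marginals, total mass and entropies. -/

section Derivatives

variable {d k : ℕ} {t t₁ : ℝ}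

theorem ae_hasDerivWithinAt_marginal {ρ : ℝ → (Fin (d + 1) → ℝ) → ℝ} (ht : t < t₁)
    (hm : ∀ s ∈ Icc t t₁, Measurable (ρ s)) (hi : Integrable (ρ t))
    (hreg : RightDiffDominated ρ t t₁) :
    ∀ᵐ y, HasDerivWithinAt (fun s => marginal (ρ s) y)
      (marginal (fun x => derivWithin (fun s => ρ s x) (Ici t) t) y) (Ici t) t := by
  obtain ⟨hd, G, hG, hdom⟩ := hreg
  filter_upwards [ae_ae_cons hd, ae_integrable_cons hG, ae_ae_cons hdom, ae_integrable_cons hi]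
    with y h1 h2 h3 h4
  refine (hasDerivWithinAt_integral_of_dominated_slopes
    (f := fun s (a : ℝ) => ρ s (Fin.cons a y)) ht (fun s hs => ?_) h4 h2 h3 fun u hu => ?_).2
  · exact ((hm s hs).comp (continuous_cons.measurable.comp
      (measurable_id.prodMk measurable_const))).aestronglyMeasurable
  · filter_upwards [h1] with a ha
    exact (tendsto_slope_of_hasDerivWithinAt_Ici ha.hasDerivWithinAt).comp hu

theorem integral_derivWithin_eq_zero {p : ℝ → (Fin k → ℝ) → ℝ} (ht : t < t₁)
    (hm : ∀ s ∈ Icc t t₁, Measurable (p s)) (hi : Integrable (p t))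
    (h1 : ∀ s ∈ Icc t t₁, ∫ x, p s x = 1) (hreg : RightDiffDominated p t t₁) :
    ∫ x, derivWithin (fun s => p s x) (Ici t) t = 0 := by
  obtain ⟨hd, G, hG, hdom⟩ := hreg
  have h := (hasDerivWithinAt_integral_of_dominated_slopes ht
    (fun s hs => (hm s hs).aestronglyMeasurable) hi hG hdom
    (f' := fun x => derivWithin (fun s => p s x) (Ici t) t) fun u hu => ?_).2
  · refine (uniqueDiffWithinAt_Ici t).eq_deriv _ h ?_
    refine (hasDerivWithinAt_const t (Ici t) (1 : ℝ)).congr_of_eventuallyEq ?_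
      (h1 t (left_mem_Icc.2 ht.le))
    filter_upwards [Icc_mem_nhdsGE ht] with s hs using h1 s hs
  · filter_upwards [hd] with x hx
    exact (tendsto_slope_of_hasDerivWithinAt_Ici hx.hasDerivWithinAt).comp hu

theorem hasDerivWithinAt_integral_mul_log {w : ℝ → (Fin k → ℝ) → ℝ} {w' : (Fin k → ℝ) → ℝ}
    (ht : t < t₁) (hm : ∀ s ∈ Icc t t₁, Measurable (w s)) (h0 : ∀ s ∈ Icc t t₁, ∀ y, 0 ≤ w s y)
    (hi : Integrable fun y => w t y * Real.log (w t y))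
    (hw : ∀ᵐ y, HasDerivWithinAt (fun s => w s y) (w' y) (Ici t) t)
    (hdom : DominatedQuotients (fun s y => w s y * Real.log (w s y)) t t₁)
    (hzero : ∀ᵐ y, w t y = 0 →
      (fun s => w s y * Real.log (w s y)) =o[𝓝[>] t] (fun s => s - t)) :
    Integrable (fun y => w' y + w' y * Real.log (w t y)) ∧
    HasDerivWithinAt (fun s => ∫ y, w s y * Real.log (w s y))
      (∫ y, (w' y + w' y * Real.log (w t y))) (Ici t) t := by
  obtain ⟨G, hG, hdom⟩ := hdom
  refine hasDerivWithinAt_integral_of_dominated_slopes ht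
    (fun s hs => ((hm s hs).mul (hm s hs).log).aestronglyMeasurable) hi hG hdom fun u hu => ?_
  filter_upwards [hw, hzero] with y hy hz
  by_cases hwy : w t y = 0
  -- At a zero of w the formula w' + w' log w gives the true limit 0 only if w' = 0, which the o(s -
  -- t) hypothesis forces.
  · have hw0 : w' y = 0 := by
      refine deriv_eq_zero_of_mul_log_isLittleO hy hwy ?_ (hz hwy)
      filter_upwards [Ioo_mem_nhdsGT ht] with s hs using h0 s (Ioo_subset_Icc_self hs) y
    rw [hw0, hwy]
    simp only [zero_mul, add_zero, sub_zero]
    refine ((hz hwy).tendsto_div_nhds_zero.comp hu).congr fun n => ?_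
    simp [div_eq_inv_mul]
  · have hs := (tendsto_slope_of_hasDerivWithinAt_Ici hy).comp hu
    have h := tendsto_slope_mul_log (q := fun s => w s y) (r := fun s => w s y) hu hwy hs hs
    rwa [mul_div_cancel₀ _ hwy, add_comm] at h

theorem hasDerivWithinAt_integral_mul_log_frozen {q : ℝ → (Fin (d + 1) → ℝ) → ℝ}
    {q' K : (Fin (d + 1) → ℝ) → ℝ} {r : ℝ → ℝ → (Fin d → ℝ) → ℝ} {p : (Fin d → ℝ) → ℝ}
    (ht : t < t₁) (hqm : ∀ s ∈ Icc t t₁, Measurable (q s))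
    (hrm : ∀ s ∈ Icc t t₁, Measurable (fun z : ℝ × (Fin d → ℝ) => r s z.1 z.2))
    (hrt : ∀ a y, r t a y = p y) (hK : Measurable K)
    (hq : ∀ᵐ x, HasDerivWithinAt (fun s => q s x) (q' x) (Ici t) t)
    (hr : ∀ a : ℝ, ∀ᵐ y : Fin d → ℝ,
      HasDerivWithinAt (fun s => r s a y) (K (Fin.cons a y)) (Ici t) t)
    (hi : Integrable fun x : Fin (d + 1) → ℝ => q t x * Real.log (p (others x)))
    (hdom : DominatedQuotients
      (fun s (x : Fin (d + 1) → ℝ) => q s x * Real.log (r s (x 0) (others x))) t t₁)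
    (hzero : ∀ᵐ x : Fin (d + 1) → ℝ, p (others x) = 0 →
      (fun s => q s x * Real.log (r s (x 0) (others x))) =o[𝓝[>] t] (fun s => s - t)) :
    Integrable (fun x : Fin (d + 1) → ℝ =>
      q' x * Real.log (p (others x)) + q t x * (K x / p (others x))) ∧
    HasDerivWithinAt
      (fun s => ∫ x : Fin (d + 1) → ℝ, q s x * Real.log (r s (x 0) (others x)))
      (∫ x : Fin (d + 1) → ℝ,
        (q' x * Real.log (p (others x)) + q t x * (K x / p (others x)))) (Ici t) t := by
  obtain ⟨G, hG, hdom⟩ := hdom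
  have hrm' : ∀ s ∈ Icc t t₁,
      Measurable (fun x : Fin (d + 1) → ℝ => r s (x 0) (others x)) := fun s hs =>
    (hrm s hs).comp ((measurable_pi_apply 0).prodMk continuous_others.measurable)
  refine hasDerivWithinAt_integral_of_dominated_slopes ht
    (fun s hs => ((hqm s hs).mul (hrm' s hs).log).aestronglyMeasurable) (by simpa only [hrt] using hi)
    hG hdom fun u hu => ?_
  -- Dropping the first N terms puts every time in (t, t₁), where r is measurable; the set of
  -- convergence of the slopes of r is then measurable, and the null sets for the separate values of
  -- a can be glued.
  obtain ⟨N, hN⟩ := eventually_atTop.1 (hu.eventually (Ioo_mem_nhdsGT ht))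
  have huN : Tendsto (fun n => u (n + N)) atTop (𝓝[>] t) := hu.comp (tendsto_add_atTop_nat N)
  have hrlim : ∀ᵐ x : Fin (d + 1) → ℝ, Tendsto (fun n => (u (n + N) - t)⁻¹ *
      (r (u (n + N)) (x 0) (others x) - r t (x 0) (others x))) atTop (𝓝 (K x)) := by
    refine ae_of_forall_ae_cons (measurableSet_tendsto_fun (fun n => ?_) hK) fun a => ?_
    · exact ((hrm' _ (Ioo_subset_Icc_self (hN _ (Nat.le_add_left _ _)))).sub
        (hrm' t (left_mem_Icc.2 ht.le))).const_mul _
    · filter_upwards [hr a] with y hy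
      exact (tendsto_slope_of_hasDerivWithinAt_Ici hy).comp huN
  filter_upwards [hq, hzero, hrlim] with x hqx hz hrx
  rw [← tendsto_add_atTop_iff_nat N]
  by_cases hpx : p (others x) = 0
  · have h := (hz hpx).tendsto_div_nhds_zero.comp huN
    -- With log 0 = 0 and division by 0 equal to 0, the claimed limit is 0 whatever q' is.
    simp only [hrt, hpx, Real.log_zero, mul_zero, div_zero, add_zero, sub_zero]
    refine h.congr fun n => ?_
    simp [div_eq_inv_mul]
  · have h := tendsto_slope_mul_log (q := fun s => q s x) (r := fun s => r s (x 0) (others x)) huN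
      (by rwa [hrt]) ((tendsto_slope_of_hasDerivWithinAt_Ici hqx).comp huN) hrx
    simpa only [hrt] using h

end Derivatives

/-! ### The drift and noise integrands, and the singular factor 1/p. -/

section Terms

variable {d m : ℕ} {F : ℝ → (Fin (d + 1) → ℝ) → Fin (d + 1) → ℝ}
  {B : ℝ → (Fin (d + 1) → ℝ) → Matrix (Fin (d + 1)) (Fin m) ℝ}
  {ρ : ℝ → (Fin (d + 1) → ℝ) → ℝ} {t : ℝ}

theorem gMat_eq_of_additive (hadd : ∀ s x x', B s x = B s x') (x : Fin (d + 1) → ℝ)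
    (i j : Fin (d + 1)) : gMat B t x i j = gMat B t 0 i j := by
  simp [gMat, hadd t x 0]

theorem noiseTerm_eq (hadd : ∀ s x x', B s x = B s x') (x : Fin (d + 1) → ℝ) :
    noiseTerm B ρ t x = 1 / marginal (ρ t) (others x) * ∑ i : Fin d, ∑ j : Fin d,
      gMat B t 0 i.succ j.succ * pd i (fun z => pd j (marginal (ρ t)) z) (others x) := by
  simp only [noiseTerm, gMat_eq_of_additive hadd, Finset.mul_sum]
  refine Finset.sum_congr rfl fun i _ => Finset.sum_congr rfl fun j _ => ?_
  simp only [pd_const_mul, pd_succ, others_cons]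

theorem driftTerm_eq (x : Fin (d + 1) → ℝ) :
    driftTerm F ρ t x = 1 / marginal (ρ t) (others x) * ∑ i : Fin d,
      pd i.succ (fun z => F t z i.succ * marginal (ρ t) (others z)) x := by
  simp only [driftTerm, Finset.mul_sum]

/-- The conditional density of `x_1` given the other components is integrable over the
(compact) support. -/
theorem integrable_mul_inv_marginal {f : (Fin (d + 1) → ℝ) → ℝ} (hf : Continuous f)
    (hfs : HasCompactSupport f) (hf0 : ∀ x, 0 ≤ f x) :
    Integrable fun x => f x * (1 / marginal f (others x)) := by
  have hm := measurable_marginal hf.measurable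
  have hs := hasCompactSupport_marginal hfs
  refine integrable_mul_others (h := fun y => 1 / marginal f y)
    (hf.integrable_of_hasCompactSupport hfs) hf0 (hm.const_div 1) ?_
  -- After x_1 is integrated out, the weight is p · (1/p), at most the indicator of the compact
  -- support of p.
  have hK : Integrable (indicator (tsupport (marginal f)) fun _ => (1 : ℝ)) :=
    (integrable_indicator_iff hs.isCompact.isClosed.measurableSet).2
      (integrableOn_const hs.isCompact.measure_lt_top.ne)
  refine hK.mono' (hm.mul (hm.const_div 1)).aestronglyMeasurable (ae_of_all _ fun y => ?_)
  by_cases hy : marginal f y = 0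
  · simp only [hy, zero_mul, norm_zero]
    exact indicator_nonneg (fun _ _ => zero_le_one) _
  · rw [indicator_of_mem (subset_tsupport _ hy), mul_one_div_cancel hy, norm_one]

/-- Where f ≠ 0 the continuous factor N is bounded by compactness, so the weight f/p controls the
product even though 1/p is unbounded. -/
theorem integrable_mul_inv_marginal_mul {f N : (Fin (d + 1) → ℝ) → ℝ} (hf : Continuous f)
    (hfs : HasCompactSupport f) (hf0 : ∀ x, 0 ≤ f x) (hN : Continuous N) :
    Integrable fun x => f x * (1 / marginal f (others x) * N x) := by
  have hA := integrable_mul_inv_marginal hf hfs hf0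
  obtain ⟨C, hC⟩ := hfs.isCompact.exists_bound_of_continuousOn hN.continuousOn
  have h := hA.aestronglyMeasurable.mul hN.aestronglyMeasurable
  refine (hA.norm.mul_const C).mono' (h.congr (ae_of_all _ fun x => mul_assoc _ _ _))
    (ae_of_all _ fun x => ?_)
  by_cases hx : f x = 0
  · simp [hx]
  · rw [← mul_assoc, norm_mul]
    exact mul_le_mul_of_nonneg_left (hC x (subset_tsupport _ hx)) (norm_nonneg _)

/-- The second derivatives of a nonnegative function vanish almost everywhere on its zero set. -/
theorem ae_pd_pd_eq_zero {k : ℕ} {p : (Fin k → ℝ) → ℝ} (hp : ContDiff ℝ 2 p) (hp0 : ∀ y, 0 ≤ p y)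
    (i j : Fin k) : ∀ᵐ y, p y = 0 → pd i (fun z => pd j p z) y = 0 := by
  have hj : ContDiff ℝ 1 (fun z => pd j p z) := contDiff_pd hp (by norm_num) j
  have hjd := hj.differentiable one_ne_zero
  filter_upwards [ae_fderiv_eq_zero_of_eq_zero hjd] with y hy h0
  -- A zero of p ≥ 0 is a minimum, so it is also a zero of ∂_j p, and almost everywhere on the zero
  -- set of ∂_j p its gradient vanishes.
  have hmin : IsLocalMin p y := Eventually.of_forall fun z => by rw [h0]; exact hp0 z
  have hz : pd j p y = 0 := by
    rw [pd_eq_fderiv (hp.differentiable two_ne_zero y), hmin.fderiv_eq_zero]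
    rfl
  rw [pd_eq_fderiv (hjd y), hy hz]
  rfl

end Terms

end InfoFlow

/-! ### The information flow for additive noise. -/

open InfoFlow

theorem corollary1 {d m : ℕ} {Ω : Type*} [MeasurableSpace Ω]
    (P : Measure Ω) [IsProbabilityMeasure P]
    -- the system `dx = F(x, s) ds + B(x, s) dw` on `ℝⁿ`, `n = d + 1`
    (F : ℝ → (Fin (d + 1) → ℝ) → Fin (d + 1) → ℝ)
    (B : ℝ → (Fin (d + 1) → ℝ) → Matrix (Fin (d + 1)) (Fin m) ℝ)
    (hF : ContDiff ℝ 1 (fun z : ℝ × (Fin (d + 1) → ℝ) => F z.1 z.2))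
    (hB : Continuous (fun z : ℝ × (Fin (d + 1) → ℝ) => B z.1 z.2))
    (t t₁ : ℝ) (ht : t < t₁)
    -- the original system and its density
    (X : ℝ → Ω → Fin (d + 1) → ℝ) (hX : InfoFlow.IsSolution F B t t₁ P X)
    (ρ : ℝ → (Fin (d + 1) → ℝ) → ℝ)
    (hρ : ∀ s ∈ Icc t t₁, InfoFlow.IsDensity P (X s) (ρ s))
    (hρ_smooth : ContDiff ℝ 2 (ρ t)) (hρ_supp : HasCompactSupport (ρ t))
    -- the modified system, with `x_1` frozen from time `t` on, and its densities
    (Y : ℝ → Ω → Fin d → ℝ) (hY : InfoFlow.IsModified F B t t₁ P X Y)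
    (q : ℝ → (Fin (d + 1) → ℝ) → ℝ)
    (hq : ∀ s ∈ Icc t t₁,
      InfoFlow.IsDensity P (fun ω => (Fin.cons (X t ω 0) (Y s ω) : Fin (d + 1) → ℝ)) (q s))
    (r : ℝ → ℝ → (Fin d → ℝ) → ℝ)
    (hr : InfoFlow.IsFrozenDensity F B t t₁ (InfoFlow.marginal (ρ t)) r)
    (hreg : InfoFlow.RegularInTime ρ q r t t₁)
    -- additive noise
    (hadd : ∀ s x x', B s x = B s x') :
    -- both rates of change of entropy exist
    DifferentiableWithinAt ℝ (InfoFlow.entropyOthers ρ) (Ici t) t ∧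
    DifferentiableWithinAt ℝ (InfoFlow.entropyExcl P t X Y r) (Ici t) t ∧
    -- the stochastic term vanishes
    Integrable (fun ω => InfoFlow.noiseTerm B ρ t (X t ω)) P ∧
    (1 / 2) * ∫ ω, InfoFlow.noiseTerm B ρ t (X t ω) ∂P = 0 ∧
    -- the information flow
    Integrable (fun ω => InfoFlow.driftTerm F ρ t (X t ω)) P ∧
    InfoFlow.infoFlow P t X Y ρ r = -∫ ω, InfoFlow.driftTerm F ρ t (X t ω) ∂P := by
  have htm : t ∈ Icc t t₁ := left_mem_Icc.2 ht.le
  have hX0 : ∀ s ∈ Icc t t₁, Measurable (X s) := fun s hs => hX.measurable hs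
  have hYm : ∀ s ∈ Icc t t₁,
      Measurable (fun ω => (Fin.cons (X t ω 0) (Y s ω) : Fin (d + 1) → ℝ)) :=
    fun s hs => hY.solution.measurable hs
  set p : (Fin d → ℝ) → ℝ := marginal (ρ t) with hp_def
  have hρt0 := (hρ t htm).nonneg
  have hρti := (hρ t htm).integrable (hX0 t htm)
  have hp0 : ∀ y, 0 ≤ p y := marginal_nonneg hρt0
  have hp2 : ContDiff ℝ 2 p := contDiff_marginal (n := 2) hρ_smooth hρ_supp
  have hps : HasCompactSupport p := hasCompactSupport_marginal hρ_supp
  have hpm : Measurable p := hp2.continuous.measurable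
  have hF0 := hF.continuous
  -- the two initial densities agree
  have hqρ : ρ t =ᵐ[volume] q t := by
    have h := hq t htm
    simp only [hY.initial, cons_others] at h
    exact (hρ t htm).ae_eq h (hX0 t htm)
  have hqi : Integrable (q t) := hρti.congr hqρ
  -- continuity of the coefficients of the modified systems
  have hFs : Continuous (fun z : ℝ × (Fin (d + 1) → ℝ) => stopDrift F z.1 z.2) :=
    continuous_pi fun i => Fin.cases (by simpa [stopDrift] using continuous_const)
      (fun j => by simpa [stopDrift] using! (continuous_apply j.succ).comp hF0) i
  have hBs : Continuous (fun z : ℝ × (Fin (d + 1) → ℝ) => stopNoise B z.1 z.2) :=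
    continuous_matrix fun i l => Fin.cases (by simpa [stopNoise] using continuous_const)
      (fun j => by simpa [stopNoise] using! hB.matrix_elem j.succ l) i
  have hc : ∀ a : ℝ, Continuous fun z : ℝ × (Fin d → ℝ) =>
      (z.1, (Fin.cons a z.2 : Fin (d + 1) → ℝ)) := fun a =>
    continuous_fst.prodMk (continuous_cons.comp (continuous_const.prodMk continuous_snd))
  have hFa : ∀ a, Continuous (fun z : ℝ × (Fin d → ℝ) => paramDrift F a z.1 z.2) := fun a =>
    continuous_pi fun i => (continuous_apply i.succ).comp (hF0.comp (hc a))
  have hBa : ∀ a, Continuous (fun z : ℝ × (Fin d → ℝ) => paramNoise B a z.1 z.2) := fun a =>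
    continuous_matrix fun i l => (hB.comp (hc a)).matrix_elem i.succ l
  have hFt : ∀ i, ContDiff ℝ 1 fun x => F t x i := fun i =>
    (contDiff_apply ℝ ℝ i).comp (hF.comp (contDiff_const.prodMk contDiff_id))
  -- right derivatives of the densities
  set ρ' : (Fin (d + 1) → ℝ) → ℝ := fun x => derivWithin (fun s => ρ s x) (Ici t) t with hρ'
  set q' : (Fin (d + 1) → ℝ) → ℝ := fun x => derivWithin (fun s => q s x) (Ici t) t with hq'
  obtain ⟨hρ'i, hρ'w⟩ := hX.integral_mul_deriv_density ht hF0 hB hρ hreg.density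
  obtain ⟨hq'i, hq'w⟩ := hY.solution.integral_mul_deriv_density ht hFs hBs hq hreg.density_modified
  have hmarg : marginal ρ' =ᵐ[volume] marginal q' :=
    ae_eq_marginal_of_integral_mul_eq hρ'i hq'i hqρ hρ_supp hρ'w hq'w
  -- the rate of change of the frozen density
  let N₁ : (Fin (d + 1) → ℝ) → ℝ := fun x =>
    ∑ i : Fin d, pd i.succ (fun z => F t z i.succ * p (others z)) x
  let N₂ : (Fin d → ℝ) → ℝ := fun y => ∑ i : Fin d, ∑ j : Fin d,
    gMat B t 0 i.succ j.succ * pd i (fun z => pd j p z) y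
  -- The right-hand sides of the Fokker-Planck equations for all parameters a, collected into one
  -- continuous function of x = (a, y).
  let K : (Fin (d + 1) → ℝ) → ℝ := fun x => -N₁ x + (1 / 2) * N₂ (others x)
  have hN₁ : Continuous N₁ := continuous_finsetSum _ fun i _ =>
    (contDiff_pd (m := 0) ((hFt i.succ).mul ((hp2.of_le one_le_two).comp contDiff_others))
      (by simp) i.succ).continuous
  have hpd2 : ∀ i j, Continuous fun y => pd i (fun z => pd j p z) y := fun i j =>
    (contDiff_pd (m := 0) (contDiff_pd (m := 1) hp2 (by norm_num) j) (by simp) i).continuous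
  have hN₂ : Continuous N₂ := continuous_finsetSum _ fun i _ => continuous_finsetSum _ fun j _ =>
    (hpd2 i j).const_mul _
  have hN₂o : Continuous fun x : Fin (d + 1) → ℝ => N₂ (others x) := hN₂.comp continuous_others
  have hK : Continuous K := hN₁.neg.add (hN₂o.const_mul _)
  have hrK : ∀ a : ℝ, ∀ᵐ y : Fin d → ℝ,
      HasDerivWithinAt (fun s => r s a y) (K (Fin.cons a y)) (Ici t) t := by
    intro a
    obtain ⟨Ω', mΩ', P', Z, hP', hZ, hrd⟩ := hr.solution a
    have hrta : r t a = p := funext (hr.initial a)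
    have h := hZ.derivWithin_density_ae_eq ht (hFa a) (hBa a)
      (fun i => (hFt i.succ).comp (contDiff_cons.comp (contDiff_const.prodMk contDiff_id)))
      (fun x x' => by simp [paramNoise, hadd t (Fin.cons a x) (Fin.cons a x')]) hrd
      (by simpa only [hrta] using hp2) (by simpa only [hrta] using hps) (hreg.density_frozen a)
    filter_upwards [h, (hreg.density_frozen a).1] with y h1 h2
    have h3 := h2.hasDerivWithinAt
    rw [h1] at h3
    refine h3.congr_deriv ?_
    have hg : ∀ i j, gMat (paramNoise B a) t 0 i j = gMat B t 0 i.succ j.succ := fun i j => by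
      simp [gMat, paramNoise, hadd t (Fin.cons a 0) 0]
    simp only [K, N₁, N₂, pd_succ, others_cons, Fin.cons_zero, hg, hrta]
    rfl
  -- the entropy of the other components
  have hwm : ∀ s ∈ Icc t t₁, Measurable (marginal (ρ s)) := fun s hs =>
    measurable_marginal (hρ s hs).measurable
  have hplog : Integrable fun y => p y * Real.log (p y) :=
    (Real.continuous_mul_log.comp hp2.continuous).integrable_of_hasCompactSupport
      (hps.comp_left (g := fun u => u * Real.log u) (by simp))
  obtain ⟨hDoi, hDo⟩ := hasDerivWithinAt_integral_mul_log (w := fun s => marginal (ρ s))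
    (w' := marginal ρ') ht hwm (fun s hs => marginal_nonneg (hρ s hs).nonneg) hplog
    (ae_hasDerivWithinAt_marginal ht (fun s hs => (hρ s hs).measurable) hρti hreg.density)
    hreg.entropy_dominated hreg.entropy_zero
  -- the entropy with the first component excluded
  have hqlog : Integrable fun x : Fin (d + 1) → ℝ => q t x * Real.log (p (others x)) := by
    refine (integrable_mul_others (h := fun y => Real.log (p y)) hρti hρt0 hpm.log hplog).congr ?_
    filter_upwards [hqρ] with x hx
    rw [hx]
  obtain ⟨hDei, hDe⟩ := hasDerivWithinAt_integral_mul_log_frozen (q := q) (q' := q') (K := K)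
    (r := r) (p := p) ht (fun s hs => (hq s hs).measurable) hr.measurable hr.initial hK.measurable
    (hreg.density_modified.1.mono fun x hx => hx.hasDerivWithinAt) hrK hqlog hreg.excl_dominated
    hreg.excl_zero
  have hHo : HasDerivWithinAt (entropyOthers ρ)
      (-∫ y, (marginal ρ' y + marginal ρ' y * Real.log (p y))) (Ici t) t := hDo.neg
  have hHe : HasDerivWithinAt (entropyExcl P t X Y r)
      (-∫ x : Fin (d + 1) → ℝ, (q' x * Real.log (p (others x)) + q t x * (K x / p (others x))))
      (Ici t) t := by
    have h1 : ∀ s ∈ Icc t t₁, entropyExcl P t X Y r s =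
        -∫ x : Fin (d + 1) → ℝ, q s x * Real.log (r s (x 0) (others x)) := by
      intro s hs
      have h2 := (hq s hs).integral_comp (hYm s hs)
        (g := fun x => Real.log (r s (x 0) (others x)))
        ((hr.measurable s hs).comp
          ((measurable_pi_apply 0).prodMk continuous_others.measurable)).log
      rw [← h2]
      rfl
    refine hDe.neg.congr_of_eventuallyEq ?_ (h1 t htm)
    filter_upwards [Icc_mem_nhdsGE ht] with s hs using h1 s hs
  -- the two terms in the information flow
  have hdr : ∀ x, driftTerm F ρ t x = 1 / p (others x) * N₁ x := fun x => driftTerm_eq x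
  have hno : ∀ x, noiseTerm B ρ t x = 1 / p (others x) * N₂ (others x) := fun x =>
    noiseTerm_eq hadd x
  have hinvm : Measurable fun x : Fin (d + 1) → ℝ => 1 / p (others x) :=
    (hpm.comp continuous_others.measurable).const_div 1
  have hdrm : Measurable fun x => driftTerm F ρ t x := by
    simpa only [hdr] using! hinvm.mul hN₁.measurable
  have hnom : Measurable fun x => noiseTerm B ρ t x := by
    simpa only [hno] using! hinvm.mul hN₂o.measurable
  have hdri : Integrable fun x => ρ t x * driftTerm F ρ t x := by
    simpa only [hdr] using
      integrable_mul_inv_marginal_mul hρ_smooth.continuous hρ_supp hρt0 hN₁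
  have hnoi : Integrable fun x => ρ t x * noiseTerm B ρ t x := by
    simpa only [hno] using
      integrable_mul_inv_marginal_mul hρ_smooth.continuous hρ_supp hρt0 hN₂o
  have hEdr := (hρ t htm).integral_comp (hX0 t htm) hdrm
  have hEno := (hρ t htm).integral_comp (hX0 t htm) hnom
  have hnoise : ∫ x, ρ t x * noiseTerm B ρ t x = 0 := by
    -- Additivity makes the noise integrand independent of x_1, so integrating x_1 out turns ρ into
    -- p and cancels 1/p. Where p = 0 the left side is 0, and so is N₂ almost everywhere.
    have h1 : marginal (fun x => ρ t x * noiseTerm B ρ t x) =ᵐ[volume] N₂ := by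
      simp only [hno]
      rw [marginal_mul_others (ρ t) fun y => 1 / p y * N₂ y]
      filter_upwards [ae_all_iff.2 fun i => ae_all_iff.2 fun j => ae_pd_pd_eq_zero hp2 hp0 i j]
        with y hy
      by_cases h0 : p y = 0
      · simp [N₂, hy _ _ h0, ← hp_def, h0]
      · rw [← hp_def, ← mul_assoc, mul_one_div_cancel h0, one_mul]
    have hi : ∀ i j, Integrable fun y => pd i (fun z => pd j p z) y := fun i j =>
      (hpd2 i j).integrable_of_hasCompactSupport
        (hasCompactSupport_pd (hasCompactSupport_pd hps j) i)
    rw [← integral_marginal hnoi, integral_congr_ae h1]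
    simp only [N₂]
    rw [integral_finsetSum _ fun i _ => integrable_finsetSum _ fun j _ => (hi i j).const_mul _]
    simp only [integral_finsetSum _ fun j _ => (hi _ j).const_mul _, integral_const_mul,
      integral_pd (contDiff_pd (m := 1) hp2 (by norm_num) _) (hasCompactSupport_pd hps _),
      mul_zero, Finset.sum_const_zero]
  refine ⟨hHo.differentiableWithinAt, hHe.differentiableWithinAt,
    ((hρ t htm).integrable_comp_iff (hX0 t htm) hnom).2 hnoi, by rw [hEno, hnoise, mul_zero],
    ((hρ t htm).integrable_comp_iff (hX0 t htm) hdrm).2 hdri, ?_⟩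
  have hu := uniqueDiffWithinAt_Ici t
  rw [infoFlow, hHo.derivWithin hu, hHe.derivWithin hu, hEdr]
  -- conservation of mass
  have hmass : ∫ y, marginal ρ' y = 0 := by
    rw [integral_marginal hρ'i]
    exact integral_derivWithin_eq_zero ht (fun s hs => (hρ s hs).measurable) hρti
      (fun s hs => (hρ s hs).integral_eq_one (hX0 s hs)) hreg.density
  -- As log p is unbounded near the zeros of p, integrability is recovered by subtraction from the
  -- dominated limit; the same is done below for q' log p.
  have hlogi : Integrable fun y => marginal ρ' y * Real.log (p y) :=
    (hDoi.sub (integrable_marginal hρ'i)).congr (ae_of_all _ fun y => add_sub_cancel_left _ _)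
  have hKeq : (fun x => q t x * (K x / p (others x))) =ᵐ[volume]
      fun x => -(ρ t x * driftTerm F ρ t x) + (1 / 2) * (ρ t x * noiseTerm B ρ t x) := by
    filter_upwards [hqρ] with x hx
    rw [← hx, hdr, hno]
    simp only [K]
    ring
  have hdrn : Integrable fun x => -(ρ t x * driftTerm F ρ t x) := hdri.neg
  have hKi : Integrable fun x => q t x * (K x / p (others x)) :=
    (hdrn.add (hnoi.const_mul (1 / 2))).congr hKeq.symm
  have hq'logi : Integrable fun x : Fin (d + 1) → ℝ => q' x * Real.log (p (others x)) :=
    (hDei.sub hKi).congr (ae_of_all _ fun x => add_sub_cancel_right _ _)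
  have hlog : ∫ x : Fin (d + 1) → ℝ, q' x * Real.log (p (others x)) =
      ∫ y, marginal ρ' y * Real.log (p y) := by
    rw [← integral_marginal hq'logi, marginal_mul_others q' fun y => Real.log (p y)]
    refine integral_congr_ae ?_
    filter_upwards [hmarg] with y hy
    rw [hy]
  -- The mass term is 0, the two logarithmic integrals cancel, and of ∫ q K / p only the drift part
  -- survives.
  rw [integral_add (integrable_marginal hρ'i) hlogi, integral_add hq'logi hKi, hmass, hlog,
    integral_congr_ae hKeq, integral_add hdrn (hnoi.const_mul _), integral_neg,
    integral_const_mul, hnoise]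
  ring
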